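/- Let $n\ge 3$ be odd. For $t\ge 0$ let $k_0(\cdot\,;t)$ be the convolution kernel of $\sin(t|D|)/|D|$ on $\mathbb R^n$, i.e. the tempered distribution with Fourier transform $\sin(t|\xi|)/|\xi|$ (where $\hat u(\xi)=\int e^{-i\langle x,\xi\rangle}u(x)\,dx$), and let $\dot k_0=\partial_t k_0$, with Fourier transform $\cos(t|\xi|)$. For $t>0$ define distributions $Q_N(\cdot\,;t)$ on $(\mathbb R^n)^N$ by $Q_1(x;t)=k_0(x;t)$ and $$Q_N(x_1,\dots,x_N;t)=\int_0^t Q_{N-1}(x_1,\dots,x_{N-1};t-s)\,k_0(x_N;s)\,ds,\qquad N\ge 2.$$ Let $A\in\mathbb R$, and let $(\chi_N)_{N\ge1}$ be functions in $C_0^\infty(\mathbb R)$ with $\chi_N(t)=1$ for $|t|\le 1$, $\chi_N(t)=0$ for $|t|>2$, and $|\chi_N^{(k)}(t)|\le A^kN^k$ for $0\le k\le 2N+2$ and all $t$. (Such sequences exist for a suitable $A$.) For $N\ge 2$ and $R>0$ let $E_{N,R}$ be the distribution on $(\mathbb R^n)^N$ $$E_{N,R}=(-1)^{N-1}\int_0^\infty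 Q_{N-1}(x_1,\dots,x_{N-1};t)\,\dot k_0(x_N;t)\,\chi_N(t/R)\,dt ,$$ the integrals being taken in the weak sense. Put $h_\gamma(r,s)=(\gamma+|r-s|)^{-1}(\gamma+|r+s|)^{-1}$. There is a constant $C>0$, depending only on $n$ and $A$, such that for every such sequence $(\chi_N)$, every $N\ge 2$ and every $R>0$, $E_{N,R}$ is a tempered distribution whose Fourier transform $\mathcal F E_{N,R}$ is a continuous function satisfying $$|(\mathcal F E_{N,R})(\xi_1,\dots,\xi_N)|\le C^N\Big(\frac{N}{R\gamma}\Big)^{2N+1}e^{2R\gamma}\prod_{1\le j\le N-1}h_\gamma(|\xi_j|,|\xi_N|)$$ for every $\gamma>0$ and all $\xi_1,\dots,\xi_N\in\mathbb R^n$. -/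

import Mathlib

open MeasureTheory SchwartzMap
open scoped FourierTransform ContDiff LineDeriv Topology Convolution

noncomputable section

/-! ### Pairing a tempered distribution with one variable of a Schwartz function -/

section Slice

theorem fderiv_iteratedFDeriv_comm {E F : Type} [NormedAddCommGroup E] [NormedSpace ℝ E]
    [NormedAddCommGroup F] [NormedSpace ℝ F] (l : ℕ) (f : E → F) (hf : ContDiff ℝ ∞ f)
    (z v : E) :
    fderiv ℝ (iteratedFDeriv ℝ l f) z v = iteratedFDeriv ℝ l (fun w => fderiv ℝ f w v) z := by
  induction l generalizing F with
  | zero =>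
    ext m
    have h0 : DifferentiableAt ℝ f z := (hf.differentiable (by simp)) z
    rw [iteratedFDeriv_zero_eq_comp]
    rw [LinearIsometryEquiv.comp_fderiv]
    simp
  | succ l ih =>
    have hf' : ContDiff ℝ ∞ (fderiv ℝ f) := hf.fderiv_right (by simp)
    have e0 : iteratedFDeriv ℝ (l + 1) f = (continuousMultilinearCurryRightEquiv' ℝ l E F).symm ∘
        iteratedFDeriv ℝ l (fderiv ℝ f) := by
      ext1 w; exact iteratedFDeriv_succ_eq_comp_right
    have h1 := ih (fderiv ℝ f) hf'
    have hd : DifferentiableAt ℝ (iteratedFDeriv ℝ l (fderiv ℝ f)) z :=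
      (hf'.iteratedFDeriv_right (m := ∞) (by exact_mod_cast le_top)).differentiable (by simp) z
    have h3 := ((continuousMultilinearCurryRightEquiv' ℝ l E
      F).symm.toContinuousLinearEquiv.toContinuousLinearMap.hasFDerivAt.comp z hd.hasFDerivAt).fderiv
    have h4 := congrArg (fun L => L v) h3
    rw [e0]
    refine h4.trans ?_
    rw [ContinuousLinearMap.comp_apply, h1, iteratedFDeriv_succ_eq_comp_right]
    simp only [Function.comp_apply]
    have h2 : (fun w => fderiv ℝ (fderiv ℝ f) w v) = fderiv ℝ (fun w => fderiv ℝ f w v) := by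
      ext w u
      rw [fderiv_clm_apply ((hf'.differentiable (by simp)) w) (differentiableAt_const v)]
      simp
      exact ((hf.contDiffAt (x := w)).isSymmSndFDerivAt (by
        simp only [minSmoothness_of_isRCLikeNormedField]
        exact WithTop.coe_le_coe.2 le_top)).eq v u
    rw [h2]
    rfl

variable {D E : Type} [NormedAddCommGroup D] [NormedSpace ℝ D]
  [NormedAddCommGroup E] [NormedSpace ℝ E]

/-- The slice `y ↦ Φ (x, y)` of a Schwartz function of two variables. -/
def schwartzSlice (x : D) : 𝓢(D × E, ℂ) →L[ℂ] 𝓢(E, ℂ) :=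
  compCLM ℂ (g := fun y : E => (x, y))
    (by
      have h : (fun y : E => (x, y)) = fun y => (x, (0 : E)) + ContinuousLinearMap.inr ℝ D E y := by
        ext y <;> simp
      rw [h]
      exact (Function.HasTemperateGrowth.const _).add
        (ContinuousLinearMap.hasTemperateGrowth _))
    ⟨1, 1, fun y => by
      have : ‖y‖ ≤ ‖(x, y)‖ := le_max_right _ _
      rw [one_mul, pow_one]; linarith⟩

@[simp] theorem schwartzSlice_apply (x : D) (Φ : 𝓢(D × E, ℂ)) (y : E) :
    schwartzSlice x Φ y = Φ (x, y) := rfl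

theorem norm_iteratedFDeriv_slice_le {F : Type*} [NormedAddCommGroup F] [NormedSpace ℝ F]
    (g : D × E → F) (hg : ContDiff ℝ ∞ g) (x : D) (y : E) (l : ℕ) :
    ‖iteratedFDeriv ℝ l (fun y => g (x, y)) y‖ ≤ ‖iteratedFDeriv ℝ l g (x, y)‖ := by
  have h : (fun y : E => g (x, y)) =
      (fun z => g ((x, (0 : E)) + z)) ∘ ContinuousLinearMap.inr ℝ D E := by
    ext y; simp
  rw [h, ContinuousLinearMap.iteratedFDeriv_comp_right (n := ∞) _ (by fun_prop) _ (by
    exact_mod_cast le_top), iteratedFDeriv_comp_add_left]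
  refine (ContinuousMultilinearMap.norm_compContinuousLinearMap_le _ _).trans ?_
  have : ∏ _i : Fin l, ‖ContinuousLinearMap.inr ℝ D E‖ ≤ 1 :=
    Finset.prod_le_one (fun _ _ => norm_nonneg _)
      (fun _ _ => ContinuousLinearMap.norm_inr_le_one ℝ D E)
  simp only [ContinuousLinearMap.inr_apply, Prod.mk_add_mk, add_zero, zero_add]
  exact mul_le_of_le_one_right (norm_nonneg _) this

theorem iteratedFDeriv_taylor (f : E → ℂ) (hf : ContDiff ℝ ∞ f) (l : ℕ) (z v : E) (M : ℝ)
    (hM : ∀ s ∈ segment ℝ z (z + v), ‖iteratedFDeriv ℝ (l + 2) f s‖ ≤ M) :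
    ‖iteratedFDeriv ℝ l f (z + v) - iteratedFDeriv ℝ l f z
      - fderiv ℝ (iteratedFDeriv ℝ l f) z v‖ ≤ M * ‖v‖ ^ 2 := by
  have h0 : 0 ≤ M := (norm_nonneg _).trans (hM z (left_mem_segment ℝ _ _))
  have hs : ∀ k, Differentiable ℝ (iteratedFDeriv ℝ k f) := fun k =>
    (hf.iteratedFDeriv_right (m := ∞) (by exact_mod_cast le_top)).differentiable (by simp)
  have h1 : ∀ s ∈ segment ℝ z (z + v),
      ‖fderiv ℝ (iteratedFDeriv ℝ l f) s - fderiv ℝ (iteratedFDeriv ℝ l f) z‖ ≤ M * ‖v‖ := by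
    intro s hsm
    have e : ‖fderiv ℝ (iteratedFDeriv ℝ l f) s - fderiv ℝ (iteratedFDeriv ℝ l f) z‖ =
        ‖iteratedFDeriv ℝ (l + 1) f s - iteratedFDeriv ℝ (l + 1) f z‖ := by
      rw [iteratedFDeriv_succ_eq_comp_left]
      simp only [Function.comp_apply]
      have h2 := (continuousMultilinearCurryLeftEquiv ℝ (fun _ : Fin (l + 1) => E) ℂ).symm.dist_map
        (fderiv ℝ (iteratedFDeriv ℝ l f) s) (fderiv ℝ (iteratedFDeriv ℝ l f) z)
      exact (dist_eq_norm _ _).symm.trans (h2.symm.trans (dist_eq_norm _ _))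
    rw [e]
    refine ((convex_segment z (z + v)).norm_image_sub_le_of_norm_fderiv_le
      (fun x _ => hs (l + 1) x) (fun x hx => by
        rw [norm_fderiv_iteratedFDeriv]; exact hM x hx) (left_mem_segment ℝ _ _) hsm).trans ?_
    gcongr
    simpa using norm_sub_le_of_mem_segment hsm
  have := (convex_segment z (z + v)).norm_image_sub_le_of_norm_fderiv_le'
      (fun x _ => hs l x) h1 (left_mem_segment ℝ _ _) (right_mem_segment ℝ _ _)
  simpa [pow_two, mul_assoc] using this

theorem seminorm_slice_le (Φ : 𝓢(D × E, ℂ)) (x : D) (j k l : ℕ) :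
    ‖x‖ ^ j * SchwartzMap.seminorm ℂ k l (schwartzSlice x Φ) ≤
      SchwartzMap.seminorm ℂ (j + k) l Φ := by
  have : ‖((‖x‖ : ℂ)) ^ j‖ = ‖x‖ ^ j := by simp
  rw [← this, ← map_smul_eq_mul]
  refine SchwartzMap.seminorm_le_bound ℂ k l _ (by positivity) fun y => ?_
  have h1 : ‖iteratedFDeriv ℝ l (⇑((‖x‖ : ℂ) ^ j • schwartzSlice x Φ)) y‖
      = ‖x‖ ^ j * ‖iteratedFDeriv ℝ l (fun y => Φ (x, y)) y‖ := by
    have : (⇑((‖x‖ : ℂ) ^ j • schwartzSlice x Φ)) = (‖x‖ : ℂ) ^ j • (fun y => Φ (x, y)) := by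
      ext y; simp
    rw [this, iteratedFDeriv_const_smul_apply, norm_smul]
    · simp
    · exact ((schwartzSlice x Φ).smooth l).contDiffAt
  rw [h1]
  have h2 := norm_iteratedFDeriv_slice_le Φ (Φ.smooth ⊤) x y l
  have h3 := SchwartzMap.le_seminorm ℂ (j + k) l Φ (x, y)
  refine le_trans ?_ h3
  rw [pow_add]
  calc _ = ‖x‖ ^ j * ‖y‖ ^ k * ‖iteratedFDeriv ℝ l (fun y => Φ (x, y)) y‖ := by ring
    _ ≤ _ := by
      gcongr
      · exact le_max_left _ _
      · exact le_max_right _ _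

theorem iteratedFDeriv_remainder (f : E → ℂ) (hf : ContDiff ℝ ∞ f) (l : ℕ) (z v : E) :
    iteratedFDeriv ℝ l (fun z => f (z + v) - f z - fderiv ℝ f z v) z =
      iteratedFDeriv ℝ l f (z + v) - iteratedFDeriv ℝ l f z
        - fderiv ℝ (iteratedFDeriv ℝ l f) z v := by
  have hc : ∀ (f : E → ℂ), ContDiff ℝ ∞ f → ∀ z, ContDiffAt ℝ l f z := fun f hf z =>
    (hf.of_le (by exact_mod_cast le_top)).contDiffAt
  have s1 : ContDiff ℝ ∞ (fun z => f (z + v)) := hf.comp (by fun_prop)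
  have s2 : ContDiff ℝ ∞ (fun z => fderiv ℝ f z v) :=
    (hf.fderiv_right (m := ∞) (by simp)).clm_apply contDiff_const
  have a1 : iteratedFDeriv ℝ l (fun z => f (z + v) - f z - fderiv ℝ f z v) z =
      iteratedFDeriv ℝ l (fun z => f (z + v) - f z) z -
        iteratedFDeriv ℝ l (fun z => fderiv ℝ f z v) z :=
    iteratedFDeriv_sub_apply (hc _ (s1.sub hf) _) (hc _ s2 _)
  have a2 : iteratedFDeriv ℝ l (fun z => f (z + v) - f z) z =
      iteratedFDeriv ℝ l (fun z => f (z + v)) z - iteratedFDeriv ℝ l f z :=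
    iteratedFDeriv_sub_apply (hc _ s1 _) (hc _ hf _)
  rw [a1, a2, iteratedFDeriv_comp_add_right, fderiv_iteratedFDeriv_comm l f hf]

theorem weighted_taylor_bound (f : E → ℂ) (hf : ContDiff ℝ ∞ f) (l : ℕ) (z v : E) (c P : ℝ)
    (hc : 0 ≤ c) (hP : ∀ s ∈ segment ℝ z (z + v), c * ‖iteratedFDeriv ℝ (l + 2) f s‖ ≤ P) :
    c * ‖iteratedFDeriv ℝ l (fun z => f (z + v) - f z - fderiv ℝ f z v) z‖ ≤ P * ‖v‖ ^ 2 := by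
  rcases hc.eq_or_lt with rfl | hc
  · have := hP z (left_mem_segment ℝ _ _)
    rw [zero_mul] at this ⊢
    positivity
  · rw [iteratedFDeriv_remainder f hf]
    have h := iteratedFDeriv_taylor f hf l z v (P / c) (by
        intro s hs
        rw [le_div_iff₀ hc, mul_comm]
        exact hP s hs)
    calc _ ≤ c * (P / c * ‖v‖ ^ 2) := by gcongr
      _ = _ := by field_simp

theorem seminorm_remainder_le (Φ : 𝓢(D × E, ℂ)) (x h : D) (k l : ℕ) :
    SchwartzMap.seminorm ℂ k l (schwartzSlice (x + h) Φ - schwartzSlice x Φ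
      - schwartzSlice x (∂_{((h, 0) : D × E)} Φ)) ≤
      SchwartzMap.seminorm ℂ k (l + 2) Φ * ‖h‖ ^ 2 := by
  refine SchwartzMap.seminorm_le_bound ℂ k l _ (by positivity) fun y => ?_
  have hΦ : ContDiff ℝ ∞ Φ := Φ.smooth ⊤
  have hRs : ContDiff ℝ ∞ (fun z => Φ (z + (h, 0)) - Φ z - fderiv ℝ Φ z (h, 0)) := by
    have : ContDiff ℝ ∞ (fun z => Φ (z + (h, 0))) := hΦ.comp (by fun_prop)
    exact (this.sub hΦ).sub ((hΦ.fderiv_right (m := ∞) (by simp)).clm_apply contDiff_const)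
  have e1 : (⇑(schwartzSlice (x + h) Φ - schwartzSlice x Φ
      - schwartzSlice x (∂_{((h, 0) : D × E)} Φ))) =
      fun y => (fun z => Φ (z + (h, 0)) - Φ z - fderiv ℝ Φ z (h, 0)) (x, y) := by
    ext y
    simp [SchwartzMap.lineDerivOp_apply_eq_fderiv]
  rw [e1]
  refine le_trans (mul_le_mul_of_nonneg_left
    (norm_iteratedFDeriv_slice_le _ hRs x y l) (by positivity)) ?_
  have key := weighted_taylor_bound Φ hΦ l (x, y) ((h, 0) : D × E) (‖y‖ ^ k)
    (SchwartzMap.seminorm ℂ k (l + 2) Φ) (by positivity) (by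
      intro s hs
      have hs2 : s.2 = y := by
        rw [segment_eq_image'] at hs
        obtain ⟨θ, -, rfl⟩ := hs
        simp
      refine le_trans ?_ (SchwartzMap.le_seminorm ℂ k (l + 2) Φ s)
      rw [← hs2]
      gcongr
      exact le_max_right _ _)
  have hh : ‖((h, 0) : D × E)‖ = ‖h‖ := by simp
  rwa [hh] at key

theorem tempered_bound (T : 𝓢'(E, ℂ)) : ∃ (s : Finset (ℕ × ℕ)) (C : ℝ), 0 ≤ C ∧
    ∀ φ : 𝓢(E, ℂ), ‖T φ‖ ≤ C * ∑ p ∈ s, SchwartzMap.seminorm ℂ p.1 p.2 φ := by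
  have hc : Continuous T := ContinuousLinearMap.continuous (T : 𝓢(E, ℂ) →L[ℂ] ℂ)
  obtain ⟨s, C, -, h⟩ := Seminorm.bound_of_continuous (schwartz_withSeminorms ℂ E ℂ)
    ((normSeminorm ℂ ℂ).comp (T : 𝓢(E, ℂ) →ₗ[ℂ] ℂ)) (continuous_norm.comp hc)
  refine ⟨s, C, C.2, fun φ => (h φ).trans ?_⟩
  simp only [smul_apply]
  have := Seminorm.finset_sup_le_sum (schwartzSeminormFamily ℂ E ℂ) s φ
  refine mul_le_mul_of_nonneg_left (this.trans (le_of_eq ?_)) C.2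
  simp [schwartzSeminormFamily]

/-- The function `x ↦ ⟨T, Φ (x, ·)⟩`. -/
def pairSnd (T : 𝓢'(E, ℂ)) (Φ : 𝓢(D × E, ℂ)) (x : D) : ℂ := T (schwartzSlice x Φ)

theorem pairSnd_decay (T : 𝓢'(E, ℂ)) (Φ : 𝓢(D × E, ℂ)) (j : ℕ) :
    ∃ C, ∀ x, ‖x‖ ^ j * ‖pairSnd T Φ x‖ ≤ C := by
  obtain ⟨s, C, hC, h⟩ := tempered_bound T
  refine ⟨C * ∑ p ∈ s, SchwartzMap.seminorm ℂ (j + p.1) p.2 Φ, fun x => ?_⟩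
  calc _ ≤ ‖x‖ ^ j * (C * ∑ p ∈ s, SchwartzMap.seminorm ℂ p.1 p.2 (schwartzSlice x Φ)) := by
        gcongr; exact h _
    _ = C * ∑ p ∈ s, ‖x‖ ^ j * SchwartzMap.seminorm ℂ p.1 p.2 (schwartzSlice x Φ) := by
        rw [mul_left_comm, Finset.mul_sum]
    _ ≤ _ := by
        gcongr; exact seminorm_slice_le _ _ _ _ _

variable [FiniteDimensional ℝ D]

theorem pairSnd_hasFDerivAt (T : 𝓢'(E, ℂ)) (Φ : 𝓢(D × E, ℂ)) (x : D) :
    HasFDerivAt (pairSnd T Φ)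
      (∑ i, (((Module.finBasis ℝ D).coord i).toContinuousLinearMap.smulRight
        (pairSnd T (∂_{((Module.finBasis ℝ D i, 0) : D × E)} Φ) x))) x := by
  obtain ⟨s, C, hC, hT⟩ := tempered_bound T
  have e : ∀ h : D, (∑ i, (((Module.finBasis ℝ D).coord i).toContinuousLinearMap.smulRight
        (pairSnd T (∂_{((Module.finBasis ℝ D i, 0) : D × E)} Φ) x))) h =
        pairSnd T (∂_{((h, 0) : D × E)} Φ) x := by
    intro h
    have h1 : ((h, 0) : D × E) = ∑ i, (Module.finBasis ℝ D).coord i h •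
        ((Module.finBasis ℝ D i, 0) : D × E) := by
      ext
      · simp [Prod.fst_sum, (Module.finBasis ℝ D).sum_repr]
      · simp [Prod.snd_sum]
    have h2 : ∂_{((h, 0) : D × E)} Φ = ∑ i, (((Module.finBasis ℝ D).coord i h : ℝ) : ℂ) •
        ∂_{((Module.finBasis ℝ D i, 0) : D × E)} Φ := by
      ext z
      simp only [SchwartzMap.lineDerivOp_apply_eq_fderiv, sum_apply, smul_apply]
      rw [h1, map_sum]
      refine Finset.sum_congr rfl fun i _ => ?_
      rw [map_smul, Complex.real_smul, smul_eq_mul]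
    rw [h2]
    simp only [pairSnd, map_sum, map_smul, smul_eq_mul, sum_apply]
    refine Finset.sum_congr rfl fun i _ => ?_
    simp
  rw [hasFDerivAt_iff_isLittleO_nhds_zero]
  refine Asymptotics.IsBigO.trans_isLittleO (g := fun h : D => ‖h‖ ^ 2) ?_ ?_
  · refine Asymptotics.IsBigO.of_bound
      (C * ∑ p ∈ s, SchwartzMap.seminorm ℂ p.1 (p.2 + 2) Φ) (.of_forall fun h => ?_)
    rw [e]
    simp only [pairSnd, ← map_sub]
    refine (hT _).trans ?_
    rw [norm_pow, norm_norm, mul_assoc, Finset.sum_mul]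
    gcongr
    exact seminorm_remainder_le _ _ _ _ _
  · simpa using (Asymptotics.isLittleO_norm_pow_id (E' := D) (n := 2) (by norm_num))

theorem pairSnd_contDiff (T : 𝓢'(E, ℂ)) (n : ℕ) (Φ : 𝓢(D × E, ℂ)) :
    ContDiff ℝ n (pairSnd T Φ) := by
  induction n generalizing Φ with
  | zero =>
    exact contDiff_zero.2 (continuous_iff_continuousAt.2
      fun x => (pairSnd_hasFDerivAt T Φ x).continuousAt)
  | succ n ih =>
    rw [Nat.cast_succ, contDiff_succ_iff_hasFDerivAt]
    exact ⟨_, ContDiff.sum fun i _ => contDiff_const.smulRight (ih _), pairSnd_hasFDerivAt T Φ⟩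

theorem pairSnd_iterated_decay (T : 𝓢'(E, ℂ)) (j n : ℕ) (Φ : 𝓢(D × E, ℂ)) :
    ∃ C, ∀ x, ‖x‖ ^ j * ‖iteratedFDeriv ℝ n (pairSnd T Φ) x‖ ≤ C := by
  induction n generalizing Φ with
  | zero => simpa using pairSnd_decay T Φ j
  | succ n ih =>
    choose B hB using fun i => ih (∂_{((Module.finBasis ℝ D i, 0) : D × E)} Φ)
    let c := fun i => ‖ContinuousLinearMap.smulRightL ℝ D ℂ
      (((Module.finBasis ℝ D).coord i).toContinuousLinearMap)‖
    refine ⟨∑ i, c i * B i, fun x => ?_⟩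
    have h1 : fderiv ℝ (pairSnd T Φ) = ∑ i, (ContinuousLinearMap.smulRightL ℝ D ℂ
      (((Module.finBasis ℝ D).coord i).toContinuousLinearMap)) ∘
        (pairSnd T (∂_{((Module.finBasis ℝ D i, 0) : D × E)} Φ)) := by
      ext1 x
      rw [(pairSnd_hasFDerivAt T Φ x).fderiv, Finset.sum_apply]
      rfl
    rw [← norm_iteratedFDeriv_fderiv, h1, iteratedFDeriv_sum_apply]
    · calc _ ≤ ‖x‖ ^ j * ∑ i, c i * ‖iteratedFDeriv ℝ n
            (pairSnd T (∂_{((Module.finBasis ℝ D i, 0) : D × E)} Φ)) x‖ := by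
            gcongr
            refine (norm_sum_le _ _).trans (Finset.sum_le_sum fun i _ => ?_)
            exact ContinuousLinearMap.norm_iteratedFDeriv_comp_left _
              ((pairSnd_contDiff T n _).contDiffAt) le_rfl
        _ = ∑ i, c i * (‖x‖ ^ j * ‖iteratedFDeriv ℝ n
            (pairSnd T (∂_{((Module.finBasis ℝ D i, 0) : D × E)} Φ)) x‖) := by
            rw [Finset.mul_sum]; exact Finset.sum_congr rfl fun i _ => by ring
        _ ≤ _ := by
            gcongr with i _
            exact hB i x
    · intro i _
      exact ((ContinuousLinearMap.contDiff _).comp (pairSnd_contDiff T n _)).contDiffAt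

/-- The partial pairing `x ↦ ⟨T, Φ (x, ·)⟩` of a tempered distribution `T` in the second variable
with a Schwartz function `Φ` of two variables; it is again a Schwartz function. The tensor product of
a distribution `S` in the first variable with `T` is `(S ⊗ T)(Φ) = S (partialPairing T Φ)`. -/
def partialPairing (T : 𝓢'(E, ℂ)) (Φ : 𝓢(D × E, ℂ)) : 𝓢(D, ℂ) where
  toFun x := T (schwartzSlice x Φ)
  smooth' := contDiff_infty.2 fun n => pairSnd_contDiff T n Φ
  decay' j n := pairSnd_iterated_decay T j n Φ

end Slice

/-! ### The kernels of the wave group -/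

theorem norm_sincSymbol_le {V : Type} [NormedAddCommGroup V] [NormedSpace ℝ V] (t : ℝ) (ξ : V) :
    ‖((t * Real.sinc (t * ‖(2 * Real.pi) • ξ‖) : ℝ) : ℂ)‖ ≤ |t| := by
  rw [Complex.norm_real, norm_mul, Real.norm_eq_abs, Real.norm_eq_abs]
  exact mul_le_of_le_one_right (abs_nonneg t) (Real.abs_sinc_le_one _)

/-- `ℝⁿ`. -/
abbrev Rn (n : ℕ) : Type := EuclideanSpace ℝ (Fin n)

/-- `(ℝⁿ)^N`, with the Euclidean inner product. -/
abbrev RnPow (n N : ℕ) : Type := PiLp 2 (fun _ : Fin N => Rn n)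

/-- The convolution kernel of the Fourier multiplier `m(D)`, `D = -i∂`, for a bounded measurable
symbol `m`: the tempered distribution `k` with `k̂ = m`, in the normalisation
`k̂(η) = ∫ exp (-i ⟨x, η⟩) k(x) dx`. Mathlib's `𝓕` has the phase `exp (-2πi ⟨x, ξ⟩)`, so
`𝓕 k (ξ) = m (2πξ)`. -/
def multiplierKernel {n : ℕ} (m : Rn n → ℂ)
    (hm : MemLp (fun ξ : Rn n => m ((2 * Real.pi) • ξ)) ⊤ volume) : 𝓢'(Rn n, ℂ) :=
  𝓕⁻ (Lp.toTemperedDistribution hm.toLp)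

theorem multiplierKernel_apply {n : ℕ} (m : Rn n → ℂ)
    (hm : MemLp (fun ξ : Rn n => m ((2 * Real.pi) • ξ)) ⊤ volume) (φ : 𝓢(Rn n, ℂ)) :
    multiplierKernel m hm φ = ∫ ξ, 𝓕⁻ φ ξ * m ((2 * Real.pi) • ξ) := by
  rw [multiplierKernel, TemperedDistribution.fourierInv_apply, Lp.toTemperedDistribution_apply]
  refine integral_congr_ae ?_
  filter_upwards [hm.coeFn_toLp] with ξ h
  rw [h, smul_eq_mul]

theorem memLp_sinSymbol (n : ℕ) (t : ℝ) : MemLp (fun ξ : Rn n =>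
    (fun η : Rn n => ((t * Real.sinc (t * ‖η‖) : ℝ) : ℂ)) ((2 * Real.pi) • ξ)) ⊤ volume := by
  refine memLp_top_of_bound ?_ |t| (.of_forall fun ξ => norm_sincSymbol_le t ξ)
  have := Real.continuous_sinc
  exact Continuous.aestronglyMeasurable (by fun_prop)

theorem memLp_cosSymbol (n : ℕ) (t : ℝ) : MemLp (fun ξ : Rn n =>
    (fun η : Rn n => ((Real.cos (t * ‖η‖) : ℝ) : ℂ)) ((2 * Real.pi) • ξ)) ⊤ volume := by
  refine memLp_top_of_bound (Continuous.aestronglyMeasurable (by fun_prop)) 1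
    (.of_forall fun ξ => ?_)
  rw [Complex.norm_real]
  exact Real.abs_cos_le_one _

/-- The convolution kernel `k₀(·; t)` of `sin (t|D|) / |D|`: its symbol is
`sin (t|η|) / |η| = t sinc (t|η|)`, with the value `t` at `η = 0`. -/
def waveKernel (n : ℕ) (t : ℝ) : 𝓢'(Rn n, ℂ) :=
  multiplierKernel (fun η => ((t * Real.sinc (t * ‖η‖) : ℝ) : ℂ)) (memLp_sinSymbol n t)

/-- The time derivative `∂ₜ k₀(·; t)`, i.e. the convolution kernel of `cos (t|D|)`; it is the
derivative of `k₀(·; t)` in `t` by `waveKernel_hasDerivAt`. -/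
def waveKernelDot (n : ℕ) (t : ℝ) : 𝓢'(Rn n, ℂ) :=
  multiplierKernel (fun η => ((Real.cos (t * ‖η‖) : ℝ) : ℂ)) (memLp_cosSymbol n t)

theorem waveKernel_hasDerivAt (n : ℕ) (φ : 𝓢(Rn n, ℂ)) (t : ℝ) :
    HasDerivAt (fun s => waveKernel n s φ) (waveKernelDot n t φ) t := by
  simp only [waveKernel, waveKernelDot, multiplierKernel_apply]
  have hi : Integrable (fun ξ => (𝓕⁻ φ) ξ) (volume : Measure (Rn n)) :=
    (𝓕⁻ φ).integrable
  have hsc := Real.continuous_sinc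
  have hc : Continuous (fun ξ => (𝓕⁻ φ) ξ) := (𝓕⁻ φ).continuous
  refine (hasDerivAt_integral_of_dominated_loc_of_deriv_le (μ := volume)
    (F := fun s (ξ : Rn n) => (𝓕⁻ φ) ξ *
      ((s * Real.sinc (s * ‖(2 * Real.pi) • ξ‖) : ℝ) : ℂ))
    (F' := fun s (ξ : Rn n) => (𝓕⁻ φ) ξ * ((Real.cos (s * ‖(2 * Real.pi) • ξ‖) : ℝ) : ℂ))
    (bound := fun ξ => ‖(𝓕⁻ φ) ξ‖) (s := Set.univ) Filter.univ_mem ?_ ?_ ?_ ?_ hi.norm ?_).2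
  · exact .of_forall fun s => Continuous.aestronglyMeasurable (by fun_prop)
  · exact hi.mul_bdd (c := |t|) (Continuous.aestronglyMeasurable (by fun_prop))
      (.of_forall fun ξ => norm_sincSymbol_le t ξ)
  · exact Continuous.aestronglyMeasurable (by fun_prop)
  · refine .of_forall fun ξ s _ => ?_
    rw [norm_mul]
    refine mul_le_of_le_one_right (norm_nonneg _) ?_
    rw [Complex.norm_real]
    exact Real.abs_cos_le_one _
  · refine .of_forall fun ξ s _ => HasDerivAt.const_mul _ (HasDerivAt.ofReal_comp ?_)
    set r := ‖(2 * Real.pi) • ξ‖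
    by_cases hr : r = 0
    · simp only [hr, mul_zero, Real.sinc_zero, mul_one, Real.cos_zero]
      exact hasDerivAt_id s
    · have e : (fun s : ℝ => s * Real.sinc (s * r)) = fun s => Real.sin (s * r) / r := by
        ext s
        by_cases hs : s = 0
        · simp [hs]
        · rw [Real.sinc_of_ne_zero (mul_ne_zero hs hr)]
          field_simp
      rw [e]
      have := (((hasDerivAt_id s).mul_const r).sin).div_const r
      simpa [hr] using this

/-! ### The distributions in several variables -/

/-- `((x₁, …, x_N), y) ↦ (x₁, …, x_N, y)`. -/
def snocEquiv (n N : ℕ) : (RnPow n N × Rn n) ≃L[ℝ] RnPow n (N + 1) where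
  toFun p := WithLp.toLp 2 (Fin.snoc (α := fun _ => Rn n) p.1 p.2)
  invFun x := (WithLp.toLp 2 (fun j => x j.castSucc), x (Fin.last N))
  map_add' p q := by
    ext j : 1
    refine Fin.lastCases ?_ (fun i => ?_) j
    · simp only [PiLp.add_apply, Fin.snoc_last, Prod.snd_add]
    · simp only [PiLp.add_apply, Fin.snoc_castSucc, Prod.fst_add]
  map_smul' c p := by
    ext j : 1
    refine Fin.lastCases ?_ (fun i => ?_) j
    · simp only [PiLp.smul_apply, Fin.snoc_last, Prod.smul_snd, RingHom.id_apply]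
    · simp only [PiLp.smul_apply, Fin.snoc_castSucc, Prod.smul_fst, RingHom.id_apply]
  left_inv p := by
    refine Prod.ext ?_ ?_
    · ext j : 1
      simp only [Fin.snoc_castSucc]
    · simp only [Fin.snoc_last]
  right_inv x := by
    ext j : 1
    refine Fin.lastCases ?_ (fun i => ?_) j
    · simp only [Fin.snoc_last]
    · simp only [Fin.snoc_castSucc]
  continuous_toFun := by
    refine (PiLp.continuous_toLp 2 _).comp (continuous_pi fun j => ?_)
    refine Fin.lastCases ?_ (fun i => ?_) j
    · simp only [Fin.snoc_last]; exact continuous_snd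
    · simp only [Fin.snoc_castSucc]
      exact (PiLp.continuous_apply 2 _ i).comp continuous_fst
  continuous_invFun := by
    refine Continuous.prodMk ((PiLp.continuous_toLp 2 _).comp (continuous_pi fun j => ?_)) ?_
    · exact PiLp.continuous_apply 2 _ _
    · exact PiLp.continuous_apply 2 _ _

/-- The identification of `ℝⁿ` with `(ℝⁿ)^1`. -/
def singleEquiv (n : ℕ) : Rn n ≃L[ℝ] RnPow n 1 where
  toFun y := WithLp.toLp 2 (fun _ => y)
  invFun x := x 0
  map_add' _ _ := rfl
  map_smul' _ _ := rfl
  left_inv _ := rfl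
  right_inv x := by
    ext j : 1
    rw [Subsingleton.elim j 0]
  continuous_toFun := (PiLp.continuous_toLp 2 _).comp (continuous_pi fun _ => continuous_id)
  continuous_invFun := PiLp.continuous_apply 2 _ _

/-- For `T ∈ 𝓢'(ℝⁿ)` and `Φ ∈ 𝓢((ℝⁿ)^{N+1})`, the Schwartz function
`(x₁, …, x_N) ↦ ⟨T, Φ (x₁, …, x_N, ·)⟩`. Thus `⟨S ⊗ T, Φ⟩ = ⟨S, pairLast T Φ⟩`. -/
def pairLast {n N : ℕ} (T : 𝓢'(Rn n, ℂ)) (Φ : 𝓢(RnPow n (N + 1), ℂ)) : 𝓢(RnPow n N, ℂ) :=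
  partialPairing T (compCLMOfContinuousLinearEquiv ℂ (snocEquiv n N) Φ)

/-- `waveQ n N t Φ = ⟨Q_N(·; t), Φ⟩`, where `Q_1(x; t) = k₀(x; t)` and, for `N ≥ 2`,
`Q_N(x₁, …, x_N; t) = ∫₀ᵗ Q_{N-1}(x₁, …, x_{N-1}; t - s) k₀(x_N; s) ds`. The value for `N = 0`
is a placeholder. -/
def waveQ (n : ℕ) : (N : ℕ) → ℝ → 𝓢(RnPow n N, ℂ) → ℂ
  | 0, _, _ => 0
  | 1, t, Φ => waveKernel n t (compCLMOfContinuousLinearEquiv ℂ (singleEquiv n) Φ)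
  | N + 2, t, Φ => ∫ s in (0 : ℝ)..t, waveQ n (N + 1) (t - s) (pairLast (waveKernel n s) Φ)

/-- `cutoffE n χ N R Φ = ⟨E_{N,R}, Φ⟩`, where, for `N ≥ 2`,
`E_{N,R} = (-1)^{N-1} ∫₀^∞ Q_{N-1}(x₁, …, x_{N-1}; t) ∂ₜk₀(x_N; t) χ_N(t / R) dt`.
The values for `N = 0, 1` are placeholders. -/
def cutoffE (n : ℕ) (χ : ℕ → ℝ → ℂ) : (N : ℕ) → ℝ → 𝓢(RnPow n N, ℂ) → ℂ
  | 0, _, _ => 0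
  | N + 1, R, Φ => (-1) ^ N *
      ∫ t in Set.Ioi (0 : ℝ), waveQ n N t (pairLast (waveKernelDot n t) Φ) * χ (N + 1) (t / R)

/-- The Fourier transform of the tempered distribution `E`, in the normalisation
`Ê(ξ) = ∫ exp (-i ⟨x, ξ⟩) E(x) dx`, is the continuous function `F`. Mathlib's `𝓕` has the phase
`exp (-2πi ⟨x, ξ⟩)`, so this says that `𝓕 E` is the function `ξ ↦ F (2πξ)`. -/
def HasFourierTransform {n N : ℕ} (E : 𝓢'(RnPow n N, ℂ)) (F : RnPow n N → ℂ) : Prop :=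
  Continuous F ∧ ∀ φ : 𝓢(RnPow n N, ℂ), 𝓕 E φ = ∫ ξ, F ((2 * Real.pi) • ξ) * φ ξ

/-- `h_γ(r, s) = (γ + |r - s|)⁻¹ (γ + |r + s|)⁻¹`. -/
def hWeight (γ r s : ℝ) : ℝ := (γ + |r - s|)⁻¹ * (γ + |r + s|)⁻¹

/-! ### Cut-off functions -/

/-- The cut-off functions `χ_N`, `N ≥ 1`, with constant `A`: `χ_N ∈ C₀^∞(ℝ)`, `χ_N = 1` on
`[-1, 1]`, `χ_N(t) = 0` for `|t| > 2`, and `|χ_N^{(k)}| ≤ A^k N^k` for `0 ≤ k ≤ 2N + 2`. -/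
structure IsCutoffSequence (A : ℝ) (χ : ℕ → ℝ → ℂ) : Prop where
  smooth : ∀ N, 1 ≤ N → ContDiff ℝ ∞ (χ N)
  eq_one : ∀ N, 1 ≤ N → ∀ t : ℝ, |t| ≤ 1 → χ N t = 1
  eq_zero : ∀ N, 1 ≤ N → ∀ t : ℝ, 2 < |t| → χ N t = 0
  bound : ∀ N, 1 ≤ N → ∀ k ≤ 2 * N + 2, ∀ t : ℝ,
    ‖iteratedDeriv k (χ N) t‖ ≤ A ^ k * (N : ℝ) ^ k

theorem abs_convolution_le (g f : ℝ → ℝ) (K B : ℝ) (hg : Integrable g) (hK : ∫ x, |g x| ≤ K)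
    (hB : 0 ≤ B) (hf : ∀ x, |f x| ≤ B) (x : ℝ) :
    |(g ⋆[ContinuousLinearMap.lsmul ℝ ℝ, volume] f) x| ≤ K * B := by
  rw [convolution_def, ← Real.norm_eq_abs]
  refine (norm_integral_le_integral_norm _).trans ?_
  calc _ ≤ ∫ u, |g u| * B := by
        refine integral_mono_of_nonneg (.of_forall fun _ => norm_nonneg _)
          (hg.abs.mul_const B) (.of_forall fun u => ?_)
        simp only [ContinuousLinearMap.lsmul_apply, smul_eq_mul, norm_mul, Real.norm_eq_abs]
        gcongr
        exact hf _
    _ = (∫ u, |g u|) * B := integral_mul_const _ _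
    _ ≤ _ := by gcongr

/-- A bump function of radius `a`. -/
def mollifier (a : ℝ) (ha : 0 < a) : ContDiffBump (0 : ℝ) where
  rIn := a / 2
  rOut := a
  rIn_pos := by positivity
  rIn_lt_rOut := by linarith

theorem exists_mollifier_bound : ∃ K : ℝ, 0 ≤ K ∧ ∀ a (ha : 0 < a),
    ∫ x, |deriv ((mollifier a ha).normed volume) x| ≤ K / a := by
  have hb : ∀ x a (ha : 0 < a), (mollifier a ha) x = (mollifier 1 one_pos) (a⁻¹ * x) := by
    intro x a ha
    simp only [ContDiffBump.apply, mollifier]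
    congr 1
    · field_simp
    · simp only [sub_zero, smul_eq_mul]
      field_simp
  set b := mollifier 1 one_pos with hbdef
  have hs : ContDiff ℝ ∞ b := b.contDiff
  refine ⟨(∫ x, |deriv b x|), by positivity, fun a ha => ?_⟩
  have hI : a ≤ ∫ x, (mollifier a ha) x := by
    have := (mollifier a ha).measure_closedBall_le_integral volume
    simp only [mollifier, Real.volume_real_closedBall (by positivity : (0 : ℝ) ≤ a / 2)] at this
    have h2 : 2 * (a / 2) ≤ ∫ x, (mollifier a ha) x := this
    linarith
  have hd : ∀ x, deriv ((mollifier a ha).normed volume) x =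
      a⁻¹ * deriv b (a⁻¹ * x) / ∫ x, (mollifier a ha) x := by
    intro x
    have e : (mollifier a ha).normed volume =
        fun x => b (a⁻¹ * x) / ∫ x, (mollifier a ha) x := by
      ext x; rw [ContDiffBump.normed_def, hb]
    rw [e, deriv_div_const, deriv_comp_mul_left, smul_eq_mul]
  simp only [hd, abs_div, abs_mul]
  rw [integral_div, integral_const_mul, Measure.integral_comp_mul_left (fun x => |deriv b x|)]
  simp only [inv_inv, smul_eq_mul]
  rw [abs_of_pos ha, abs_of_pos (inv_pos.2 ha), abs_of_pos (ha.trans_le hI),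
    inv_mul_cancel_left₀ ha.ne']
  gcongr

theorem cutoff_step (K a : ℝ) (ha : 0 < a) (hKa : 0 ≤ K)
    (hK : ∫ x, |deriv ((mollifier a ha).normed volume) x| ≤ K / a)
    (j : ℕ) : ∃ f : ℝ → ℝ, ContDiff ℝ ∞ f ∧ HasCompactSupport f ∧
      (∀ x, |x| ≤ 5 / 4 - j * a → f x = 1) ∧ (∀ x, 7 / 4 + j * a ≤ |x| → f x = 0) ∧
      ∀ k ≤ j, ∀ x, |iteratedDeriv k f x| ≤ (K / a) ^ k := by
  induction j with
  | zero =>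
    let b : ContDiffBump (0 : ℝ) := ⟨5 / 4, 7 / 4, by norm_num, by norm_num⟩
    refine ⟨b, b.contDiff, b.hasCompactSupport, fun x hx => ?_, fun x hx => ?_, ?_⟩
    · exact b.one_of_mem_closedBall (by simpa using hx)
    · exact b.zero_of_le_dist (by simpa using hx)
    · intro k hk x
      obtain rfl : k = 0 := by omega
      simp only [iteratedDeriv_zero, pow_zero]
      rw [abs_of_nonneg b.nonneg]
      exact b.le_one
  | succ j ih =>
    obtain ⟨f, hf, hfc, h1, h0, hk⟩ := ih
    set ψ := (mollifier a ha).normed volume with hψ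
    have hψs : ContDiff ℝ ∞ ψ := (mollifier a ha).contDiff_normed
    have hψc : HasCompactSupport ψ := (mollifier a ha).hasCompactSupport_normed
    have hψi : Integrable ψ := hψs.continuous.integrable_of_hasCompactSupport hψc
    have hψ1 : ∫ x, |ψ x| ≤ 1 := by
      have : ∀ x, |ψ x| = ψ x := fun x => abs_of_nonneg ((mollifier a ha).nonneg_normed x)
      simp only [this]
      exact (mollifier a ha).integral_normed.le
    have hψd : Integrable (deriv ψ) :=
      (hψs.continuous_deriv (by simp)).integrable_of_hasCompactSupport hψc.deriv
    have hfs : ∀ k, ContDiff ℝ ∞ (iteratedDeriv k f) := fun k => by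
      induction k with
      | zero => simpa using hf
      | succ k ih => rw [iteratedDeriv_succ]; exact (contDiff_infty_iff_deriv.1 ih).2
    have hfcs : ∀ k, HasCompactSupport (iteratedDeriv k f) := fun k => by
      induction k with
      | zero => simpa using hfc
      | succ k ih => rw [iteratedDeriv_succ]; exact ih.deriv
    have hD : ∀ k, iteratedDeriv k (ψ ⋆[ContinuousLinearMap.lsmul ℝ ℝ, volume] f) =
        (ψ ⋆[ContinuousLinearMap.lsmul ℝ ℝ, volume] (iteratedDeriv k f)) := by
      intro k
      induction k with
      | zero => simp
      | succ k ih =>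
        rw [iteratedDeriv_succ, ih, iteratedDeriv_succ]
        ext x
        exact ((hfcs k).hasDerivAt_convolution_right _ hψs.continuous.locallyIntegrable
          ((hfs k).of_le (by exact_mod_cast le_top)) x).deriv
    have hball : ∀ x y, y ∈ Metric.ball x a → |x| - a ≤ |y| ∧ |y| ≤ |x| + a := by
      intro x y hy
      rw [Metric.mem_ball, Real.dist_eq] at hy
      constructor
      · linarith [abs_sub_abs_le_abs_sub x y, abs_sub_comm x y]
      · linarith [abs_sub_abs_le_abs_sub y x]
    refine ⟨ψ ⋆[ContinuousLinearMap.lsmul ℝ ℝ, volume] f,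
      hψc.contDiff_convolution_left _ hψs hf.continuous.locallyIntegrable,
      HasCompactSupport.convolution _ hψc hfc, fun x hx => ?_, fun x hx => ?_, ?_⟩
    · have e : ∀ y, |y| ≤ |x| + a → f y = 1 := fun y hy => h1 y (by
        push_cast at hx; linarith)
      rw [hψ, ContDiffBump.normed_convolution_eq_right, e x (by linarith)]
      intro y hy
      rw [e y (hball x y hy).2, e x (by linarith)]
    · have e : ∀ y, |x| - a ≤ |y| → f y = 0 := fun y hy => h0 y (by
        push_cast at hx; linarith)
      rw [hψ, ContDiffBump.normed_convolution_eq_right, e x (by linarith)]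
      intro y hy
      rw [e y (hball x y hy).1, e x (by linarith)]
    · intro k hkj x
      rcases k with _ | k
      · have := abs_convolution_le ψ f 1 1 hψi hψ1 zero_le_one (by simpa using hk 0 (by omega)) x
        simpa using this
      · rw [iteratedDeriv_succ, hD, (hψc.hasDerivAt_convolution_left _
          (hψs.of_le (by exact_mod_cast le_top)) (hfs k).continuous.locallyIntegrable x).deriv]
        rw [pow_succ']
        exact abs_convolution_le _ _ _ _ hψd hK (by positivity) (hk k (by omega)) x

/-- Cut-off functions with these properties exist. -/
theorem exists_isCutoffSequence : ∃ A : ℝ, ∃ χ : ℕ → ℝ → ℂ, IsCutoffSequence A χ := by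
  obtain ⟨K, hK0, hK⟩ := exists_mollifier_bound
  have ha : ∀ N : ℕ, (0 : ℝ) < 1 / (4 * (2 * N + 2)) := fun N => by positivity
  choose f hf _ h1 h0 hk using fun N : ℕ => cutoff_step K _ (ha N) hK0 (hK _ (ha N)) (2 * N + 2)
  have hj : ∀ N : ℕ, ((2 * N + 2 : ℕ) : ℝ) * (1 / (4 * (2 * N + 2))) = 1 / 4 := fun N => by
    push_cast; field_simp
  refine ⟨16 * K, fun N t => (f N t : ℂ), ⟨fun N _ => ?_, fun N _ t ht => ?_, fun N _ t ht => ?_,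
    fun N hN k hk' t => ?_⟩⟩
  · exact Complex.ofRealCLM.contDiff.comp (hf N)
  · rw [h1 N t (by rw [hj]; linarith), Complex.ofReal_one]
  · rw [h0 N t (by rw [hj]; linarith), Complex.ofReal_zero]
  · have e : ‖iteratedDeriv k (fun t => (f N t : ℂ)) t‖ = |iteratedDeriv k (f N) t| := by
      rw [← norm_iteratedFDeriv_eq_norm_iteratedDeriv, ← Real.norm_eq_abs,
        ← norm_iteratedFDeriv_eq_norm_iteratedDeriv]
      exact LinearIsometry.norm_iteratedFDeriv_comp_left Complex.ofRealLI
        ((hf N).contDiffAt (x := t)) (by exact_mod_cast le_top)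
    rw [e]
    refine (hk N k hk' t).trans ?_
    rw [← mul_pow]
    have hN' : (1 : ℝ) ≤ N := by exact_mod_cast hN
    refine pow_le_pow_left₀ (div_nonneg hK0 (ha N).le) ?_ k
    rw [div_div_eq_mul_div, div_one]
    nlinarith

end

/-! On the Fourier side each `k₀(x_j; s)` becomes `sin (s r_j) / r_j` with `r_j = |ξ_j|`. The symbol
of `Q_{N-1}(·; t)` is therefore the iterated convolution `sineConv`, and `𝓕 E_{N,R}` is, up to sign,
the integral over `0 < t < 2R` of `sineConv` times `cos (t |ξ_N|) χ_N(t / R)`. The lemmas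
`waveQ_eq_integral` and `cutoffE_eq_integral` justify this by Fubini. The crude bound
`norm_sineConv_le` makes the symbol bounded for fixed `R`, so it defines a tempered distribution.

For the estimate, split the cosine into `exp (± i s t)` with `s = |ξ_N|`, and insert `exp (-γt) exp
(γt)`. Parseval turns the integral of `exp (-γt) sineConv(t)` against `exp ((γ + is)t) u(t)`, where
`u` is the cut-off, into an integral over a frequency `τ` of two factors.

The first factor is a Laplace transform on `Re μ = γ`. Since convolution becomes multiplication, it
equals `∏ ((γ + iτ)² + r_j²)⁻¹` (`laplace_sineConv`), which is at most `2^(N-1) ∏ h_γ(r_j, τ)`. Each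
`h_γ(r_j, ·)` varies slowly on the scale `γ`: replacing `τ` by `-s` costs `(1 + |s + τ| / γ)²`, and
`h_γ` is even, so `-s` may be read as `s`.

The second factor is `∫ exp ((γ + i(s + τ))t) u(t) dt`. Integrating by parts `2N + 1` times bounds
it by `exp (2Rγ) / γ` times `(|A| N / R)^(2N+1) |γ + i(s + τ)|^(-2N-1)`. Of these `2N + 1` powers,
`2(N - 1)` pay for moving the weights to `s`. The remaining three make the `τ`-integral converge,
and its size, of order `γ`, cancels the factor `1 / γ`. The two factors are combined in
`norm_integral_sineConv_mul_le`. -/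

/-! ### Iterated convolutions of `sin (t r) / r` -/

theorem hasDerivAt_mul_sinc (r t : ℝ) :
    HasDerivAt (fun s : ℝ => s * Real.sinc (s * r)) (Real.cos (t * r)) t := by
  by_cases hr : r = 0
  · simp only [hr, mul_zero, Real.sinc_zero, mul_one, Real.cos_zero]
    exact hasDerivAt_id t
  · have e : (fun s : ℝ => s * Real.sinc (s * r)) = fun s => Real.sin (s * r) / r := by
      ext s
      by_cases hs : s = 0
      · simp [hs]
      · rw [Real.sinc_of_ne_zero (mul_ne_zero hs hr)]
        field_simp
    rw [e]
    simpa [hr] using (((hasDerivAt_id t).mul_const r).sin).div_const r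

/-- Free of division, so it also covers `r = 0`. It closes the check of the antiderivative in
`laplace_mul_sinc`. -/
theorem sq_mul_mul_sinc (r t : ℝ) : r ^ 2 * (t * Real.sinc (t * r)) = r * Real.sin (t * r) := by
  by_cases h : t * r = 0
  · rcases mul_eq_zero.1 h with h | h <;> simp [h]
  · have hr : r ≠ 0 := right_ne_zero_of_mul h
    have ht : t ≠ 0 := left_ne_zero_of_mul h
    rw [Real.sinc_of_ne_zero h]
    field_simp

theorem abs_mul_sinc_le (r t : ℝ) : |t * Real.sinc (t * r)| ≤ |t| := by
  rw [abs_mul]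
  exact mul_le_of_le_one_right (abs_nonneg t) (Real.abs_sinc_le_one _)

/-- The convolution on `[0, t]` of the functions `s ↦ sin (s r_j) / r_j`, `0 ≤ j ≤ M`. -/
noncomputable def sineConv : (M : ℕ) → (Fin (M + 1) → ℝ) → ℝ → ℂ
  | 0, r, t => ((t * Real.sinc (t * r 0) : ℝ) : ℂ)
  | M + 1, r, t => ∫ s in (0 : ℝ)..t, sineConv M (fun j => r j.castSucc) (t - s) *
      ((s * Real.sinc (s * r (Fin.last (M + 1))) : ℝ) : ℂ)

theorem continuous_sineConv (M : ℕ) :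
    Continuous (fun p : (Fin (M + 1) → ℝ) × ℝ => sineConv M p.1 p.2) := by
  have hsc := Real.continuous_sinc
  induction M with
  | zero =>
    simp only [sineConv]
    fun_prop
  | succ M ih =>
    simp only [sineConv]
    refine intervalIntegral.continuous_parametric_intervalIntegral_of_continuous
      (f := fun (p : (Fin (M + 2) → ℝ) × ℝ) (s : ℝ) =>
        sineConv M (fun j => p.1 j.castSucc) (p.2 - s) *
          ((s * Real.sinc (s * p.1 (Fin.last (M + 1))) : ℝ) : ℂ)) ?_ continuous_snd
    refine Continuous.mul (ih.comp (f := fun q : ((Fin (M + 2) → ℝ) × ℝ) × ℝ =>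
      ((fun j : Fin (M + 1) => q.1.1 j.castSucc), q.1.2 - q.2)) (by fun_prop)) (by fun_prop)

/-- There are `M + 1` factors, each at most `|t|`, and `M` integrations over intervals of length at
most `|t|`. This crude bound serves only boundedness of the symbols and Fubini; the final estimate
does not use it. -/
theorem norm_sineConv_le (M : ℕ) (r : Fin (M + 1) → ℝ) (t : ℝ) :
    ‖sineConv M r t‖ ≤ |t| ^ (2 * M + 1) := by
  induction M generalizing t with
  | zero =>
    simp only [sineConv, Complex.norm_real, Real.norm_eq_abs]
    simpa using abs_mul_sinc_le (r 0) t
  | succ M ih =>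
    simp only [sineConv]
    refine (intervalIntegral.norm_integral_le_of_norm_le_const
      (C := |t| ^ (2 * M + 1) * |t|) fun s hs => ?_).trans (le_of_eq ?_)
    · have h1 : |s| ≤ |t| ∧ |t - s| ≤ |t| := by
        rcases le_total 0 t with h | h
        · rw [Set.uIoc_of_le h] at hs
          rw [abs_of_nonneg h, abs_le, abs_le]
          constructor <;> constructor <;> linarith [hs.1, hs.2]
        · rw [Set.uIoc_of_ge h] at hs
          rw [abs_of_nonpos h, abs_le, abs_le]
          constructor <;> constructor <;> linarith [hs.1, hs.2]
      rw [norm_mul, Complex.norm_real, Real.norm_eq_abs]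
      exact mul_le_mul ((ih _ _).trans (pow_le_pow_left₀ (abs_nonneg _) h1.2 _))
        ((abs_mul_sinc_le _ _).trans h1.1) (abs_nonneg _) (by positivity)
    · rw [sub_zero]; ring

/-! ### Laplace transforms -/

theorem norm_exp_neg_mul (μ : ℂ) (t : ℝ) : ‖Complex.exp (-(μ * t))‖ = Real.exp (-(μ.re * t)) := by
  simp [Complex.norm_exp]

/-- Half of the exponential decay is spent on absorbing the linear growth of `t`. -/
theorem norm_exp_mul_mul_sinc_le (μ : ℂ) (hμ : 0 < μ.re) (r t : ℝ) (ht : 0 ≤ t) :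
    ‖Complex.exp (-(μ * t)) * ((t * Real.sinc (t * r) : ℝ) : ℂ)‖ ≤
      2 / μ.re * Real.exp (-(μ.re / 2) * t) := by
  rw [norm_mul, norm_exp_neg_mul, Complex.norm_real, Real.norm_eq_abs]
  have h1 : t ≤ 2 / μ.re * Real.exp (μ.re / 2 * t) := by
    have h := Real.add_one_le_exp (μ.re / 2 * t)
    calc t = 2 / μ.re * (μ.re / 2 * t) := by field_simp
      _ ≤ _ := by gcongr; linarith
  calc _ ≤ Real.exp (-(μ.re * t)) * (2 / μ.re * Real.exp (μ.re / 2 * t)) := by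
        gcongr
        exact (abs_mul_sinc_le r t).trans (by rwa [abs_of_nonneg ht])
    _ = 2 / μ.re * (Real.exp (-(μ.re * t)) * Real.exp (μ.re / 2 * t)) := by ring
    _ = _ := by rw [← Real.exp_add]; ring_nf

theorem integrableOn_exp_mul_mul_sinc (μ : ℂ) (hμ : 0 < μ.re) (r : ℝ) :
    IntegrableOn (fun t : ℝ => Complex.exp (-(μ * t)) * ((t * Real.sinc (t * r) : ℝ) : ℂ))
      (Set.Ioi 0) := by
  have hsc := Real.continuous_sinc
  refine Integrable.mono' ((integrableOn_exp_mul_Ioi (a := -(μ.re / 2)) (by linarith) 0).const_mul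
    (2 / μ.re)) (Continuous.aestronglyMeasurable (by fun_prop)) ?_
  filter_upwards [ae_restrict_mem measurableSet_Ioi] with t ht
  exact norm_exp_mul_mul_sinc_le μ hμ r t (le_of_lt ht)

theorem sq_add_sq_ne_zero (μ : ℂ) (hμ : 0 < μ.re) (r : ℝ) : μ ^ 2 + (r : ℂ) ^ 2 ≠ 0 := by
  have e : μ ^ 2 + (r : ℂ) ^ 2 = (μ + r * Complex.I) * (μ - r * Complex.I) := by
    ring_nf
    simp
  rw [e]
  refine mul_ne_zero ?_ ?_ <;> intro h <;> have := congrArg Complex.re h <;> simp at this <;>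
    linarith

theorem laplace_mul_sinc (μ : ℂ) (hμ : 0 < μ.re) (r : ℝ) :
    ∫ t in Set.Ioi (0 : ℝ), Complex.exp (-(μ * t)) * ((t * Real.sinc (t * r) : ℝ) : ℂ) =
      (μ ^ 2 + (r : ℂ) ^ 2)⁻¹ := by
  have hne := sq_add_sq_ne_zero μ hμ r
  -- Explicit antiderivative, from integrating by parts twice. At `t = 0` it equals `-(μ² + r²)⁻¹`,
  -- and it tends to `0` at infinity.
  have hd : ∀ t : ℝ, HasDerivAt (fun t : ℝ => -(μ ^ 2 + (r : ℂ) ^ 2)⁻¹ * (Complex.exp (-(μ * t)) *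
      ((Real.cos (t * r) : ℝ) + μ * ((t * Real.sinc (t * r) : ℝ) : ℂ))))
      (Complex.exp (-(μ * t)) * ((t * Real.sinc (t * r) : ℝ) : ℂ)) t := by
    intro t
    have d1 : HasDerivAt (fun t : ℝ => Complex.exp (-(μ * t))) (Complex.exp (-(μ * t)) * -μ) t := by
      have : HasDerivAt (fun t : ℝ => -(μ * (t : ℂ))) (-μ) t := by
        simpa using ((hasDerivAt_id t).ofReal_comp.const_mul μ).fun_neg
      exact this.cexp
    have d2 := (((hasDerivAt_id t).mul_const r).cos).ofReal_comp
    have d3 := ((hasDerivAt_mul_sinc r t).ofReal_comp).const_mul μ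
    refine ((d1.mul (d2.add d3)).const_mul _).congr_deriv ?_
    have h := congrArg (fun x : ℝ => (x : ℂ)) (sq_mul_mul_sinc r t)
    simp only [Complex.ofReal_mul, Complex.ofReal_pow] at h
    simp only [id, Pi.add_apply]
    push_cast at h ⊢
    field_simp
    simp only [mul_comm (r : ℂ) (t : ℂ)] at h ⊢
    linear_combination (-1 : ℂ) * h
  rw [integral_Ioi_of_hasDerivAt_of_tendsto' (m := 0) (fun t _ => hd t)
    (integrableOn_exp_mul_mul_sinc μ hμ r)]
  · simp
  · have t1 : Filter.Tendsto (fun t : ℝ => Real.exp (-(μ.re / 2) * t)) Filter.atTop (𝓝 0) :=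
      Real.tendsto_exp_atBot.comp
        (Filter.Tendsto.const_mul_atTop_of_neg (by linarith) Filter.tendsto_id)
    have t2 := t1.const_mul (‖(μ ^ 2 + (r : ℂ) ^ 2)⁻¹‖ * (1 + ‖μ‖ * (2 / μ.re)))
    rw [mul_zero] at t2
    refine squeeze_zero_norm' ?_ t2
    filter_upwards [Filter.eventually_ge_atTop 0] with t ht
    rw [norm_mul, norm_neg, mul_assoc]
    gcongr
    rw [mul_add, add_mul, one_mul]
    refine (norm_add_le _ _).trans (add_le_add ?_ ?_)
    · rw [norm_mul, norm_exp_neg_mul, Complex.norm_real, Real.norm_eq_abs]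
      refine (mul_le_of_le_one_right (Real.exp_nonneg _) (Real.abs_cos_le_one _)).trans ?_
      refine Real.exp_le_exp.2 ?_
      nlinarith
    · rw [mul_left_comm, norm_mul, mul_assoc]
      gcongr
      exact norm_exp_mul_mul_sinc_le μ hμ r t ht

/-- The weight is multiplicative, `exp (-μt) = exp (-μs) exp (-μ(t - s))`, so it distributes over
the convolution. The factors are ordered to match `posConvolution`. -/
theorem exp_mul_sineConv_succ (μ : ℂ) (M : ℕ) (r : Fin (M + 2) → ℝ) (t : ℝ) :
    Complex.exp (-(μ * t)) * sineConv (M + 1) r t = ∫ s in (0 : ℝ)..t,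
      ContinuousLinearMap.mul ℝ ℂ
        (Complex.exp (-(μ * s)) * ((s * Real.sinc (s * r (Fin.last (M + 1))) : ℝ) : ℂ))
        (Complex.exp (-(μ * ((t - s : ℝ) : ℂ))) * sineConv M (fun j => r j.castSucc) (t - s)) := by
  simp only [sineConv]
  rw [← intervalIntegral.integral_const_mul]
  refine intervalIntegral.integral_congr fun s _ => ?_
  have : Complex.exp (-(μ * t)) =
      Complex.exp (-(μ * s)) * Complex.exp (-(μ * ((t - s : ℝ) : ℂ))) := by
    rw [← Complex.exp_add]
    congr 1
    push_cast
    ring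
  simp only [ContinuousLinearMap.mul_apply', this]
  ring

theorem integrableOn_exp_mul_sineConv (μ : ℂ) (hμ : 0 < μ.re) (M : ℕ) (r : Fin (M + 1) → ℝ) :
    IntegrableOn (fun t : ℝ => Complex.exp (-(μ * t)) * sineConv M r t) (Set.Ioi 0) := by
  induction M with
  | zero => exact integrableOn_exp_mul_mul_sinc μ hμ (r 0)
  | succ M ih =>
    have h := integrable_posConvolution (integrableOn_exp_mul_mul_sinc μ hμ (r (Fin.last (M + 1))))
      (ih fun j => r j.castSucc) (ContinuousLinearMap.mul ℝ ℂ)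
    refine h.integrableOn.congr_fun (fun t ht => ?_) measurableSet_Ioi
    rw [posConvolution, Set.indicator_of_mem ht, exp_mul_sineConv_succ]

theorem laplace_sineConv (μ : ℂ) (hμ : 0 < μ.re) (M : ℕ) (r : Fin (M + 1) → ℝ) :
    ∫ t in Set.Ioi (0 : ℝ), Complex.exp (-(μ * t)) * sineConv M r t =
      ∏ j, (μ ^ 2 + (r j : ℂ) ^ 2)⁻¹ := by
  induction M with
  | zero => simpa [sineConv] using laplace_mul_sinc μ hμ (r 0)
  | succ M ih =>
    simp only [exp_mul_sineConv_succ]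
    rw [integral_posConvolution (integrableOn_exp_mul_mul_sinc μ hμ (r (Fin.last (M + 1))))
      (integrableOn_exp_mul_sineConv μ hμ M fun j => r j.castSucc), ih, laplace_mul_sinc μ hμ,
      ContinuousLinearMap.mul_apply', mul_comm]
    exact (Fin.prod_univ_castSucc fun j => (μ ^ 2 + (r j : ℂ) ^ 2)⁻¹).symm

/-! ### The weights -/

theorem hWeight_nonneg {γ : ℝ} (hγ : 0 < γ) (r s : ℝ) : 0 ≤ hWeight γ r s := by
  unfold hWeight; positivity

theorem hWeight_neg_right (γ r s : ℝ) : hWeight γ r (-s) = hWeight γ r s := by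
  simp only [hWeight, sub_neg_eq_add, ← sub_eq_add_neg, mul_comm]

theorem inv_add_abs_le {γ : ℝ} (hγ : 0 < γ) (a b : ℝ) :
    (γ + |a|)⁻¹ ≤ (γ + |b|)⁻¹ * (1 + |a - b| / γ) := by
  rw [inv_mul_eq_div, inv_eq_one_div, div_le_div_iff₀ (by positivity) (by positivity), one_mul]
  have h1 : |b| ≤ |a| + |a - b| := by
    have := abs_sub_abs_le_abs_sub b a
    rw [abs_sub_comm b a] at this
    linarith
  have h2 : 0 ≤ |a - b| / γ * |a| := by positivity
  calc γ + |b| ≤ γ + |a| + |a - b| + |a - b| / γ * |a| := by linarith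
    _ = _ := by field_simp; ring

/-- Moving `τ` to `s` shifts both `r - τ` and `r + τ` by `|τ - s|`. Each of the two factors then
changes by at most `1 + |τ - s| / γ`. -/
theorem hWeight_le_hWeight_mul {γ : ℝ} (hγ : 0 < γ) (r s τ : ℝ) :
    hWeight γ r τ ≤ hWeight γ r s * (1 + |τ - s| / γ) ^ 2 := by
  have h1 := inv_add_abs_le hγ (r - τ) (r - s)
  have h2 := inv_add_abs_le hγ (r + τ) (r + s)
  rw [show r - τ - (r - s) = -(τ - s) by ring, abs_neg] at h1
  rw [show r + τ - (r + s) = τ - s by ring] at h2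
  calc hWeight γ r τ ≤ ((γ + |r - s|)⁻¹ * (1 + |τ - s| / γ)) *
        ((γ + |r + s|)⁻¹ * (1 + |τ - s| / γ)) := by
        unfold hWeight; gcongr
    _ = _ := by unfold hWeight; ring

theorem add_abs_le_norm (γ σ : ℝ) :
    γ + |σ| ≤ Real.sqrt 2 * ‖(γ : ℂ) + σ * Complex.I‖ := by
  rw [Complex.norm_add_mul_I, ← Real.sqrt_mul (by norm_num)]
  refine Real.le_sqrt_of_sq_le ?_
  nlinarith [sq_nonneg (γ - |σ|), sq_abs σ]

/-- The denominator factors as `(γ + i(r + τ)) (γ - i(r - τ))`. Each factor loses `√2` in the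
comparison of `γ + |σ|` with `|γ + iσ|`, which gives the constant `2`. -/
theorem norm_inv_sq_add_sq_le {γ : ℝ} (hγ : 0 < γ) (r τ : ℝ) :
    ‖(((γ : ℂ) + τ * Complex.I) ^ 2 + (r : ℂ) ^ 2)⁻¹‖ ≤ 2 * hWeight γ r τ := by
  have e : ((γ : ℂ) + τ * Complex.I) ^ 2 + (r : ℂ) ^ 2 =
      (γ + (r + τ : ℝ) * Complex.I) * (γ + (-(r - τ) : ℝ) * Complex.I) := by
    push_cast
    ring_nf
    simp
  have h1 := add_abs_le_norm γ (r + τ)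
  have h2 := add_abs_le_norm γ (-(r - τ))
  rw [abs_neg] at h2
  have h3 := mul_le_mul h1 h2 (by positivity) (by positivity)
  rw [mul_mul_mul_comm, Real.mul_self_sqrt (by norm_num), ← norm_mul, ← e] at h3
  have h4 : 0 < (γ + |r + τ|) * (γ + |r - τ|) := by positivity
  rw [norm_inv, hWeight, ← mul_inv, mul_comm (γ + |r - τ|), ← div_eq_mul_inv, inv_eq_one_div,
    div_le_div_iff₀ (by linarith) h4]
  linarith

/-! ### Oscillatory integrals with a cut-off -/

theorem norm_exp_mul_mul_le_indicator (μ : ℂ) (v : ℝ → ℂ) {T c : ℝ} (h0 : ∀ t, T < t → v t = 0)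
    (hb : ∀ t, ‖v t‖ ≤ c) (t : ℝ) :
    ‖Complex.exp (μ * t) * v t‖ ≤ (Set.Iic T).indicator (fun t => c * Real.exp (μ.re * t)) t := by
  by_cases ht : t ≤ T
  · rw [Set.indicator_of_mem (Set.mem_Iic.2 ht), norm_mul, Complex.norm_exp, mul_comm,
      Complex.re_mul_ofReal]
    exact mul_le_mul_of_nonneg_right (hb t) (Real.exp_nonneg _)
  · rw [h0 t (not_le.1 ht), mul_zero, norm_zero, Set.indicator_of_notMem (by simpa using ht)]

theorem integrable_exp_mul (μ : ℂ) (hμ : 0 < μ.re) (v : ℝ → ℂ) (hv : Continuous v) {T c : ℝ}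
    (h0 : ∀ t, T < t → v t = 0) (hb : ∀ t, ‖v t‖ ≤ c) :
    Integrable (fun t : ℝ => Complex.exp (μ * t) * v t) := by
  refine Integrable.mono' (IntegrableOn.integrable_indicator
    ((integrableOn_exp_mul_Iic hμ T).const_mul c) measurableSet_Iic)
    (Continuous.aestronglyMeasurable (by fun_prop)) (.of_forall fun t => ?_)
  exact norm_exp_mul_mul_le_indicator μ v h0 hb t

theorem norm_integral_exp_mul_le (μ : ℂ) (hμ : 0 < μ.re) (v : ℝ → ℂ) {T c : ℝ}
    (h0 : ∀ t, T < t → v t = 0) (hb : ∀ t, ‖v t‖ ≤ c) :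
    ‖∫ t : ℝ, Complex.exp (μ * t) * v t‖ ≤ c * (Real.exp (T * μ.re) / μ.re) := by
  refine (norm_integral_le_of_norm_le (IntegrableOn.integrable_indicator
    ((integrableOn_exp_mul_Iic hμ T).const_mul c) measurableSet_Iic)
    (.of_forall (norm_exp_mul_mul_le_indicator μ v h0 hb))).trans (le_of_eq ?_)
  rw [integral_indicator measurableSet_Iic, integral_const_mul, integral_exp_mul_Iic hμ, mul_comm T]

/-- There are no boundary terms: `v` vanishes to the right of `T`, and `exp (μt)` decays to the left
while `v` stays bounded. -/
theorem integral_exp_mul_eq_deriv (μ : ℂ) (hμ : 0 < μ.re) (v : ℝ → ℂ) (hv : ContDiff ℝ 1 v)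
    {T c d : ℝ} (h0 : ∀ t, T < t → v t = 0) (hb : ∀ t, ‖v t‖ ≤ c) (hd0 : ∀ t, T < t → deriv v t = 0)
    (hdb : ∀ t, ‖deriv v t‖ ≤ d) :
    ∫ t : ℝ, Complex.exp (μ * t) * v t = -μ⁻¹ * ∫ t : ℝ, Complex.exp (μ * t) * deriv v t := by
  have hne : μ ≠ 0 := by rintro rfl; simp at hμ
  have i1 := integrable_exp_mul μ hμ v hv.continuous h0 hb
  have i2 := integrable_exp_mul μ hμ _ (hv.continuous_deriv le_rfl) hd0 hdb
  have hE : ∀ t : ℝ, HasDerivAt (fun t : ℝ => Complex.exp (μ * t)) (μ * Complex.exp (μ * t)) t := by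
    intro t
    have : HasDerivAt (fun t : ℝ => μ * (t : ℂ)) μ t := by
      simpa using (hasDerivAt_id t).ofReal_comp.const_mul μ
    exact this.cexp.congr_deriv (mul_comm _ _)
  have h := integral_mul_deriv_eq_deriv_mul_of_integrable
    (u := fun t : ℝ => Complex.exp (μ * t)) (v := v)
    (u' := fun t : ℝ => μ * Complex.exp (μ * t)) (v' := deriv v) (fun t _ => hE t)
    (fun t _ => (hv.differentiable (by simp) t).hasDerivAt) i2
    ((i1.const_mul μ).congr (.of_forall fun t => by simp [mul_assoc])) i1
  rw [h]
  simp only [mul_assoc]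
  rw [integral_const_mul]
  field_simp

theorem iteratedDeriv_eq_zero_of_gt (u : ℝ → ℂ) {T : ℝ} (h0 : ∀ t, T < t → u t = 0) (k : ℕ) (t : ℝ)
    (ht : T < t) : iteratedDeriv k u t = 0 := by
  have : u =ᶠ[𝓝 t] fun _ => (0 : ℂ) := by
    filter_upwards [Ioi_mem_nhds ht] with x hx using h0 x hx
  rw [this.iteratedDeriv_eq k, iteratedDeriv_const]
  simp

/-- Each integration by parts gains `B / ‖μ‖`. The last integral is dominated by that of `B ^ K exp
(t Re μ)` over `t ≤ T`. -/
theorem norm_integral_exp_mul_le_of_iteratedDeriv (μ : ℂ) (hμ : 0 < μ.re) (u : ℝ → ℂ)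
    (hu : ContDiff ℝ ∞ u) {T B : ℝ} (h0 : ∀ t, T < t → u t = 0) (K : ℕ)
    (hb : ∀ k ≤ K, ∀ t, ‖iteratedDeriv k u t‖ ≤ B ^ k) :
    ‖∫ t : ℝ, Complex.exp (μ * t) * u t‖ ≤ B ^ K * (Real.exp (T * μ.re) / μ.re) * ‖μ‖⁻¹ ^ K := by
  have e : ∀ k ≤ K, ∫ t : ℝ, Complex.exp (μ * t) * u t =
      (-μ⁻¹) ^ k * ∫ t : ℝ, Complex.exp (μ * t) * iteratedDeriv k u t := by
    intro k
    induction k with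
    | zero => simp
    | succ k ih =>
      intro hk
      rw [ih (by omega), integral_exp_mul_eq_deriv μ hμ (iteratedDeriv k u)
        (by
          rw [iteratedDeriv_eq_iterate]
          exact (hu.of_le (by exact_mod_cast le_top)).iterate_deriv' 1 k)
        (iteratedDeriv_eq_zero_of_gt u h0 k) (hb k (by omega))
        (by rw [← iteratedDeriv_succ]; exact iteratedDeriv_eq_zero_of_gt u h0 (k + 1))
        (by rw [← iteratedDeriv_succ]; exact hb (k + 1) hk), ← iteratedDeriv_succ, pow_succ,
        mul_assoc]
  rw [e K le_rfl, norm_mul, norm_pow, norm_neg, norm_inv, mul_comm]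
  gcongr
  exact norm_integral_exp_mul_le μ hμ _ (iteratedDeriv_eq_zero_of_gt u h0 K) (hb K le_rfl)

/-- The function `t ↦ χ_N (t / R)`, replaced by `1` on the negative half-line. -/
noncomputable def leftCutoff (χ : ℕ → ℝ → ℂ) (N : ℕ) (R t : ℝ) : ℂ :=
  if t < 0 then 1 else χ N (R⁻¹ * t)

/-- The two descriptions agree on `(-R, R)`, where `χ_N(t / R) = 1`, so the gluing at `0` is
invisible. Smoothness and the derivative bounds can then be checked locally in either description.
-/
theorem leftCutoff_eventuallyEq {A : ℝ} {χ : ℕ → ℝ → ℂ} (hχ : IsCutoffSequence A χ) {N : ℕ}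
    (hN : 1 ≤ N) {R : ℝ} (hR : 0 < R) (t : ℝ) :
    leftCutoff χ N R =ᶠ[𝓝 t] (fun _ => 1) ∨
      leftCutoff χ N R =ᶠ[𝓝 t] fun t => χ N (R⁻¹ * t) := by
  have key : ∀ x : ℝ, -R < x → x < R → χ N (R⁻¹ * x) = 1 := fun x h1 h2 => by
    refine hχ.eq_one N hN _ ?_
    rw [abs_mul, abs_of_pos (inv_pos.2 hR), inv_mul_le_iff₀ hR, mul_one]
    exact abs_le.2 ⟨h1.le, h2.le⟩
  rcases lt_or_ge t R with h | h
  · left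
    filter_upwards [Iio_mem_nhds h] with x hx
    unfold leftCutoff
    split_ifs with h0
    · rfl
    · exact key x (by linarith) hx
  · right
    filter_upwards [Ioi_mem_nhds (hR.trans_le h)] with x hx
    exact if_neg (not_lt.2 (le_of_lt hx))

theorem contDiff_leftCutoff {A : ℝ} {χ : ℕ → ℝ → ℂ} (hχ : IsCutoffSequence A χ) {N : ℕ}
    (hN : 1 ≤ N) {R : ℝ} (hR : 0 < R) : ContDiff ℝ ∞ (leftCutoff χ N R) := by
  refine contDiff_iff_contDiffAt.2 fun t => ?_
  rcases leftCutoff_eventuallyEq hχ hN hR t with h | h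
  · exact contDiffAt_const.congr_of_eventuallyEq h
  · exact (((hχ.smooth N hN).comp (by fun_prop)).contDiffAt).congr_of_eventuallyEq h

theorem leftCutoff_eq_zero {A : ℝ} {χ : ℕ → ℝ → ℂ} (hχ : IsCutoffSequence A χ) {N : ℕ}
    (hN : 1 ≤ N) {R : ℝ} (hR : 0 < R) (t : ℝ) (ht : 2 * R < t) : leftCutoff χ N R t = 0 := by
  have h0 : 0 < t := by linarith
  rw [leftCutoff, if_neg (by linarith)]
  refine hχ.eq_zero N hN _ (lt_of_lt_of_le ?_ (le_abs_self _))
  rw [inv_mul_eq_div, lt_div_iff₀ hR]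
  exact ht

theorem norm_iteratedDeriv_leftCutoff_le {A : ℝ} {χ : ℕ → ℝ → ℂ} (hχ : IsCutoffSequence A χ) {N : ℕ}
    (hN : 1 ≤ N) {R : ℝ} (hR : 0 < R) (k : ℕ) (hk : k ≤ 2 * N + 2) (t : ℝ) :
    ‖iteratedDeriv k (leftCutoff χ N R) t‖ ≤ (|A| * (N / R)) ^ k := by
  rcases leftCutoff_eventuallyEq hχ hN hR t with h | h
  · rw [h.iteratedDeriv_eq k, iteratedDeriv_const]
    split_ifs with h0
    · simp [h0]
    · rw [norm_zero]; positivity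
  · rw [h.iteratedDeriv_eq k, iteratedDeriv_comp_const_smul
      ((hχ.smooth N hN).of_le (by exact_mod_cast le_top)) R⁻¹, norm_smul, norm_pow, norm_inv,
      Real.norm_eq_abs, abs_of_pos hR]
    calc _ ≤ R⁻¹ ^ k * (A ^ k * (N : ℝ) ^ k) := by gcongr; exact hχ.bound N hN k hk _
      _ ≤ R⁻¹ ^ k * (|A| ^ k * (N : ℝ) ^ k) := by
          gcongr ?_ * (?_ * _); rw [← abs_pow]; exact le_abs_self _
      _ = _ := by rw [div_eq_mul_inv, mul_pow, mul_pow]; ring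

/-! ### Decay in frequency and the basic estimate -/

theorem inv_one_add_pow_le {y : ℝ} (hy : 0 ≤ y) (k : ℕ) :
    ((1 + y) ^ (k + 2))⁻¹ ≤ (1 + y ^ 2)⁻¹ := by
  refine inv_anti₀ (by positivity) ?_
  have h1 : 1 ≤ (1 + y) ^ k := one_le_pow₀ (by linarith)
  calc 1 + y ^ 2 ≤ 1 * (1 + y) ^ 2 := by nlinarith
    _ ≤ _ := by rw [pow_add]; gcongr

theorem integrable_inv_one_add_affine_sq {γ : ℝ} (hγ : 0 < γ) (s : ℝ) :
    Integrable (fun τ : ℝ => (1 + ((s + 2 * Real.pi * τ) / γ) ^ 2)⁻¹) := by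
  have hc : 2 * Real.pi / γ ≠ 0 := (div_pos Real.two_pi_pos hγ).ne'
  refine ((integrable_inv_one_add_sq.comp_add_left (s / γ)).comp_mul_left' hc).congr
    (.of_forall fun τ => ?_)
  simp only
  congr 3
  field_simp

/-- Rescaling by `2π / γ` reduces this to the total mass `π` of `(1 + x²)⁻¹`. The resulting factor
`γ` is what cancels `1 / γ` in the basic estimate. -/
theorem integral_inv_one_add_affine_sq {γ : ℝ} (hγ : 0 < γ) (s : ℝ) :
    ∫ τ : ℝ, (1 + ((s + 2 * Real.pi * τ) / γ) ^ 2)⁻¹ = γ / 2 := by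
  have hc : 0 < 2 * Real.pi / γ := div_pos Real.two_pi_pos hγ
  have e : ∀ τ : ℝ, (1 + ((s + 2 * Real.pi * τ) / γ) ^ 2)⁻¹ =
      (fun x : ℝ => (1 + (s / γ + x) ^ 2)⁻¹) (2 * Real.pi / γ * τ) := fun τ => by
    simp only
    congr 3
    field_simp
  simp only [e]
  rw [Measure.integral_comp_mul_left (fun x : ℝ => (1 + (s / γ + x) ^ 2)⁻¹),
    integral_add_left_eq_self (fun x : ℝ => (1 + x ^ 2)⁻¹), integral_univ_inv_one_add_sq,
    abs_of_pos (inv_pos.2 hc), smul_eq_mul]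
  have := Real.pi_pos
  field_simp

/-- `∏ⱼ h_γ(r_j, ·)` varies slowly on the scale `γ`. -/
theorem norm_prod_inv_sq_add_sq_le {γ : ℝ} (hγ : 0 < γ) {M : ℕ} (r : Fin M → ℝ) (s τ : ℝ) :
    ‖∏ j, (((γ : ℂ) + τ * Complex.I) ^ 2 + (r j : ℂ) ^ 2)⁻¹‖ ≤
      2 ^ M * (∏ j, hWeight γ (r j) s) * (1 + |s + τ| / γ) ^ (2 * M) := by
  rw [norm_prod]
  calc _ ≤ ∏ j, 2 * hWeight γ (r j) s * (1 + |s + τ| / γ) ^ 2 := by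
        refine Finset.prod_le_prod (fun _ _ => norm_nonneg _) fun j _ => ?_
        refine (norm_inv_sq_add_sq_le hγ (r j) τ).trans ?_
        -- The comparison point is `-s`, because the other Parseval factor is concentrated near `τ =
        -- -s`; evenness of `h_γ` turns it back into `s`.
        have h := hWeight_le_hWeight_mul hγ (r j) (-s) τ
        rw [hWeight_neg_right, sub_neg_eq_add, add_comm τ] at h
        linarith
    _ = _ := by
        rw [Finset.prod_mul_distrib, Finset.prod_mul_distrib]
        simp [← pow_mul]

/-- The value at `τ` is the exponential integral of `u` with `μ = γ + i(s + 2πτ)`, so repeated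
integration by parts applies. The base `2` comes from rounding `√2` up in `γ + |σ| ≤ √2 |γ + iσ|`.
-/
theorem norm_fourierInv_exp_mul_le {γ : ℝ} (hγ : 0 < γ) (s : ℝ) (u : ℝ → ℂ)
    (hu : ContDiff ℝ ∞ u) {T B : ℝ} (hB : 0 ≤ B) (h0 : ∀ t, T < t → u t = 0) (K : ℕ)
    (hb : ∀ k ≤ K, ∀ t, ‖iteratedDeriv k u t‖ ≤ B ^ k) (τ : ℝ) :
    ‖𝓕⁻ (fun t : ℝ => Complex.exp ((γ + s * Complex.I) * t) * u t) τ‖ ≤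
      (2 * (B / γ)) ^ K * (Real.exp (T * γ) / γ) *
        ((1 + |s + 2 * Real.pi * τ| / γ) ^ K)⁻¹ := by
  have e : 𝓕⁻ (fun t : ℝ => Complex.exp ((γ + s * Complex.I) * t) * u t) τ =
      ∫ t : ℝ, Complex.exp (((γ : ℂ) + (s + 2 * Real.pi * τ : ℝ) * Complex.I) * t) * u t := by
    rw [Real.fourierInv_eq']
    refine integral_congr_ae (.of_forall fun t => ?_)
    simp only [smul_eq_mul, ← mul_assoc, ← Complex.exp_add]
    congr 2
    simp
    ring
  rw [e]
  set σ := s + 2 * Real.pi * τ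
  have hre : ((γ : ℂ) + (σ : ℂ) * Complex.I).re = γ := by simp
  refine (norm_integral_exp_mul_le_of_iteratedDeriv _ (by rwa [hre]) u hu h0 K hb).trans ?_
  rw [hre]
  have h1 : ‖(γ : ℂ) + (σ : ℂ) * Complex.I‖⁻¹ ≤ 2 / γ * (1 + |σ| / γ)⁻¹ := by
    have h2 : γ + |σ| ≤ 2 * ‖(γ : ℂ) + (σ : ℂ) * Complex.I‖ := by
      refine (add_abs_le_norm γ σ).trans ?_
      gcongr
      rw [Real.sqrt_le_left (by norm_num)]
      norm_num
    have h3 : 2 / γ * (1 + |σ| / γ)⁻¹ = 2 / (γ + |σ|) := by field_simp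
    have h4 : 0 < γ + |σ| := by positivity
    rw [h3, inv_eq_one_div, div_le_div_iff₀ (by linarith) h4]
    linarith
  calc _ ≤ B ^ K * (Real.exp (T * γ) / γ) * (2 / γ * (1 + |σ| / γ)⁻¹) ^ K := by gcongr
    _ = _ := by rw [mul_pow, mul_pow, div_pow, div_pow, inv_pow]; ring

/-- The basic estimate: Parseval's formula turns the integral into one over the product of the
Laplace transforms, and the smoothness of the cut-off gives decay away from `-s`. -/
theorem norm_integral_sineConv_mul_le {γ : ℝ} (hγ : 0 < γ) (M : ℕ) (r : Fin (M + 1) → ℝ) (s : ℝ)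
    (u : ℝ → ℂ) (hu : ContDiff ℝ ∞ u) {T B : ℝ} (hB : 0 ≤ B) (h0 : ∀ t, T < t → u t = 0)
    (hb : ∀ k ≤ 2 * M + 5, ∀ t, ‖iteratedDeriv k u t‖ ≤ B ^ k) :
    ‖∫ t in Set.Ioi (0 : ℝ), sineConv M r t * (Complex.exp ((s * t : ℝ) * Complex.I) * u t)‖ ≤
      8 ^ (M + 2) * (B / γ) ^ (2 * M + 5) * Real.exp (T * γ) * ∏ j, hWeight γ (r j) s := by
  set g : ℝ → ℂ := fun t => Complex.exp ((γ + s * Complex.I) * t) * u t with hg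
  set f : ℝ → ℂ := (Set.Ioi (0 : ℝ)).indicator
    (fun t => Complex.exp (-((γ : ℂ) * t)) * sineConv M r t) with hf
  have hre : ((γ : ℂ) + (s : ℂ) * Complex.I).re = γ := by simp
  have hfi : Integrable f :=
    (integrableOn_exp_mul_sineConv (γ : ℂ) (by simpa) M r).integrable_indicator measurableSet_Ioi
  have hgc : Continuous g := by
    have := hu.continuous
    fun_prop
  have hgi : Integrable g := integrable_exp_mul _ (by rwa [hre]) u hu.continuous h0
    (fun t => by simpa using hb 0 (by omega) t)
  have hgb := norm_fourierInv_exp_mul_le hγ s u hu hB h0 _ hb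
  have hgFc : Continuous (𝓕 g) := VectorFourier.fourierIntegral_continuous
    Real.continuous_fourierChar continuous_inner hgi
  -- Integrability of the transform is needed for Fourier inversion, through which `g` enters
  -- Parseval's formula.
  have hgF : Integrable (𝓕⁻ g) := by
    have hc : Continuous (𝓕⁻ g) := by
      rw [show 𝓕⁻ g = fun τ => 𝓕 g (-τ) from funext fun τ => Real.fourierInv_eq_fourier_neg g τ]
      exact hgFc.comp continuous_neg
    refine Integrable.mono' ((integrable_inv_one_add_affine_sq hγ s).const_mul
      ((2 * (B / γ)) ^ (2 * M + 5) * (Real.exp (T * γ) / γ))) hc.aestronglyMeasurable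
      (.of_forall fun τ => (hgb τ).trans ?_)
    refine mul_le_mul_of_nonneg_left ?_ (by positivity)
    have := inv_one_add_pow_le (y := |s + 2 * Real.pi * τ| / γ) (by positivity) (2 * M + 3)
    rwa [div_pow, sq_abs, ← div_pow] at this
  have hgF' : Integrable (𝓕 g) := by
    refine hgF.comp_neg.congr (.of_forall fun τ => ?_)
    simp [Real.fourierInv_eq_fourier_neg]
  -- The Fourier transform of the damped function is the Laplace transform at `μ = γ + 2πiτ`.
  have hfF : ∀ τ, 𝓕 f τ = ∏ j, (((γ : ℂ) + (2 * Real.pi * τ : ℝ) * Complex.I) ^ 2 +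
      (r j : ℂ) ^ 2)⁻¹ := by
    intro τ
    rw [← laplace_sineConv _ (by simpa) M r, Real.fourier_eq', ← integral_indicator
      measurableSet_Ioi]
    refine integral_congr_ae (.of_forall fun t => ?_)
    simp only [hf, Set.indicator_apply]
    split_ifs with ht
    · rw [smul_eq_mul, ← mul_assoc, ← Complex.exp_add]
      congr 2
      simp
      ring
    · simp
  have e1 : ∫ t in Set.Ioi (0 : ℝ), sineConv M r t * (Complex.exp ((s * t : ℝ) * Complex.I) * u t) =
      ∫ t, f t * g t := by
    rw [← integral_indicator measurableSet_Ioi]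
    refine integral_congr_ae (.of_forall fun t => ?_)
    simp only [hf, hg, Set.indicator_apply]
    split_ifs with ht
    · have : Complex.exp ((s * t : ℝ) * Complex.I) =
          Complex.exp (-((γ : ℂ) * t)) * Complex.exp ((γ + s * Complex.I) * t) := by
        rw [← Complex.exp_add]
        congr 1
        push_cast
        ring
      rw [this]
      ring
    · simp
  -- Write `g = 𝓕 (𝓕⁻ g)` and move `𝓕` onto `f`.
  have e2 : ∫ t, f t * g t = ∫ τ, 𝓕 f τ * 𝓕⁻ g τ := by
    have h := VectorFourier.integral_fourierIntegral_smul_eq_flip (L := innerₗ ℝ)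
      Real.continuous_fourierChar continuous_inner hfi hgF
    have hflip : (innerₗ ℝ).flip = innerₗ ℝ := by ext; simp
    rw [hflip] at h
    have h2 : 𝓕 (𝓕⁻ g) = g := hgc.fourier_fourierInv_eq hgi hgF'
    calc ∫ t, f t * g t = ∫ t, f t * 𝓕 (𝓕⁻ g) t := by rw [h2]
      _ = _ := h.symm
  rw [e1, e2]
  set P := ∏ j, hWeight γ (r j) s with hP
  have hP0 : 0 ≤ P := Finset.prod_nonneg fun j _ => hWeight_nonneg hγ _ _
  refine (norm_integral_le_of_norm_le ((integrable_inv_one_add_affine_sq hγ s).const_mul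
    (2 ^ (M + 1) * P * ((2 * (B / γ)) ^ (2 * M + 5) * (Real.exp (T * γ) / γ))))
    (.of_forall fun τ => ?_)).trans ?_
  · rw [norm_mul, hfF]
    refine (mul_le_mul (norm_prod_inv_sq_add_sq_le hγ r s _) (hgb τ) (norm_nonneg _)
      (by positivity)).trans ?_
    have h1 := inv_one_add_pow_le (y := |s + 2 * Real.pi * τ| / γ) (by positivity) 1
    rw [div_pow, sq_abs, ← div_pow] at h1
    set y := |s + 2 * Real.pi * τ| / γ
    have hy : 0 ≤ y := by positivity
    calc _ = 2 ^ (M + 1) * P * ((2 * (B / γ)) ^ (2 * M + 5) * (Real.exp (T * γ) / γ)) *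
          ((1 + y) ^ (2 * (M + 1)) * ((1 + y) ^ (2 * M + 5))⁻¹) := by ring
      -- The weights consume `2(M + 1)` of the `2M + 5` powers. The three left over are more than
      -- integrability requires.
      _ = 2 ^ (M + 1) * P * ((2 * (B / γ)) ^ (2 * M + 5) * (Real.exp (T * γ) / γ)) *
          ((1 + y) ^ (1 + 2))⁻¹ := by
          rw [show 2 * M + 5 = 2 * (M + 1) + (1 + 2) by ring, pow_add (1 + y)]
          have : (1 + y) ^ (2 * (M + 1)) ≠ 0 := by positivity
          field_simp
      _ ≤ _ := by gcongr
  · rw [integral_const_mul, integral_inv_one_add_affine_sq hγ s]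
    -- One factor `2` for each of the `M + 1` weights and one for each of the `2M + 5` integrations
    -- by parts.
    have e : (8 : ℝ) ^ (M + 2) = 2 ^ (M + 1) * 2 ^ (2 * M + 5) := by
      rw [show (8 : ℝ) = 2 ^ 3 by norm_num, ← pow_mul, ← pow_add]
      congr 1
      ring
    have hX : 0 ≤ 2 ^ (M + 1) * 2 ^ (2 * M + 5) * (B / γ) ^ (2 * M + 5) * Real.exp (T * γ) * P := by
      positivity
    rw [e, mul_pow]
    calc _ = 2 ^ (M + 1) * 2 ^ (2 * M + 5) * (B / γ) ^ (2 * M + 5) * Real.exp (T * γ) * P / 2 *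
          (γ / γ) := by ring
      _ ≤ _ := by rw [div_self hγ.ne', mul_one]; exact half_le_self hX

/-! ### Partial Fourier transforms -/

section Partial

variable {V W : Type} [NormedAddCommGroup V] [InnerProductSpace ℝ V] [FiniteDimensional ℝ V]
  [MeasurableSpace V] [BorelSpace V] [NormedAddCommGroup W] [InnerProductSpace ℝ W]
  [FiniteDimensional ℝ W] [MeasurableSpace W] [BorelSpace W]

theorem toTemperedDistribution_toLp_apply {m : V → ℂ} (hm : MemLp m ⊤ volume) (φ : 𝓢(V, ℂ)) :
    Lp.toTemperedDistribution hm.toLp φ = ∫ v, φ v * m v := by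
  rw [Lp.toTemperedDistribution_apply]
  refine integral_congr_ae ?_
  filter_upwards [hm.coeFn_toLp] with v h
  rw [h, smul_eq_mul]

theorem memLp_fourierChar (x : V) :
    MemLp (fun v : V => (Real.fourierChar (-inner ℝ v x) : ℂ)) ⊤ volume := by
  refine memLp_top_of_bound (Continuous.aestronglyMeasurable ?_) 1
    (.of_forall fun v => (Circle.norm_coe _).le)
  have := Real.continuous_fourierChar
  fun_prop

/-- If `Φ` is the Fourier transform of `Ψ`, then pairing `Φ` in the second variable with the
kernel of the multiplier `m` gives the Fourier transform of `ξ ↦ ∫ Ψ (ξ, η) m η dη`. -/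
theorem fourierInv_partialPairing_apply {m : W → ℂ} (hm : MemLp m ⊤ volume) (Φ Ψ : 𝓢(V × W, ℂ))
    (h : ∀ x y, Φ (x, y) = ∫ p : V × W,
      (Real.fourierChar (-inner ℝ p.1 x) : ℂ) * (Real.fourierChar (-inner ℝ p.2 y) : ℂ) * Ψ p)
    (ξ : V) :
    𝓕⁻ (partialPairing (𝓕⁻ (Lp.toTemperedDistribution hm.toLp)) Φ) ξ =
      ∫ η, Ψ (ξ, η) * m η := by
  have hc := Real.continuous_fourierChar
  have : (volume : Measure (V × W)).IsAddHaarMeasure := by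
    rw [Measure.volume_eq_prod]
    infer_instance
  have hΨ : Integrable Ψ (volume : Measure (V × W)) := Ψ.integrable
  set b : 𝓢(V, ℂ) := partialPairing (Lp.toTemperedDistribution hm.toLp) Ψ
  have hb : ∀ ξ, b ξ = ∫ η, Ψ (ξ, η) * m η := fun ξ =>
    toTemperedDistribution_toLp_apply hm (schwartzSlice ξ Ψ)
  obtain ⟨c, hmc⟩ : ∃ c, ∀ᵐ η, ‖m η‖ ≤ c := by
    refine ⟨(eLpNormEssSup m volume).toReal, ?_⟩
    have hlt := hm.2
    rw [eLpNorm_exponent_top] at hlt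
    filter_upwards [ae_le_eLpNormEssSup (f := m)] with η hη
    rw [← toReal_enorm]
    exact ENNReal.toReal_mono hlt.ne hη
  -- By inversion it is enough to know the pairing as a Fourier transform in the first variable.
  suffices key : partialPairing (𝓕⁻ (Lp.toTemperedDistribution hm.toLp)) Φ = 𝓕 b by
    rw [key, FourierTransform.fourierInv_fourier_eq, hb]
  ext x
  -- `a` is `Ψ` transformed in the first variable only, at the point `x`. Swapping the variables
  -- lets `partialPairing` supply its Schwartz regularity, and transforming in the second variable
  -- then gives the slice of `Φ`.
  set a : 𝓢(W, ℂ) := partialPairing (Lp.toTemperedDistribution (memLp_fourierChar x).toLp)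
    (compCLMOfContinuousLinearEquiv ℂ (ContinuousLinearEquiv.prodComm ℝ W V) Ψ)
  have ha : ∀ η, a η = ∫ ξ, Ψ (ξ, η) * (Real.fourierChar (-inner ℝ ξ x) : ℂ) := fun η =>
    toTemperedDistribution_toLp_apply (memLp_fourierChar x) _
  have hFa : 𝓕 a = schwartzSlice x Φ := by
    ext y
    rw [schwartzSlice_apply, h, fourier_coe, Real.fourier_eq, Measure.volume_eq_prod,
      integral_prod_symm]
    · refine integral_congr_ae (.of_forall fun η => ?_)
      simp only [ha, Circle.smul_def, smul_eq_mul]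
      rw [← integral_const_mul]
      refine integral_congr_ae (.of_forall fun ξ => ?_)
      simp only
      ring
    · refine hΨ.bdd_mul (c := 1) (Continuous.aestronglyMeasurable (by fun_prop))
        (.of_forall fun p => by rw [norm_mul, Circle.norm_coe, Circle.norm_coe, one_mul])
  change (𝓕⁻ (Lp.toTemperedDistribution hm.toLp)) (schwartzSlice x Φ) = _
  rw [← hFa, TemperedDistribution.fourierInv_apply, FourierTransform.fourierInv_fourier_eq,
    toTemperedDistribution_toLp_apply, fourier_coe, Real.fourier_eq]
  simp only [ha, hb, Circle.smul_def, smul_eq_mul, ← integral_mul_const, ← integral_const_mul]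
  rw [integral_integral_swap]
  · refine integral_congr_ae (.of_forall fun ξ => integral_congr_ae (.of_forall fun η => ?_))
    simp only
    ring
  · have h1 : Integrable (fun p : V × W => (Real.fourierChar (-inner ℝ p.1 x) : ℂ) * Ψ p)
        (volume : Measure (V × W)) :=
      hΨ.bdd_mul (c := 1) (Continuous.aestronglyMeasurable (by fun_prop))
        (.of_forall fun p => (Circle.norm_coe _).le)
    have h2 : Integrable (fun p : V × W => m p.2 * ((Real.fourierChar (-inner ℝ p.1 x) : ℂ) * Ψ p))
        ((volume : Measure V).prod (volume : Measure W)) :=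
      h1.bdd_mul (c := c) (hm.1.comp_snd) (Measure.quasiMeasurePreserving_snd.ae hmc)
    refine h2.swap.congr (.of_forall fun p => ?_)
    simp only [Function.comp_apply, Function.uncurry, Prod.swap]
    ring

end Partial

/-! ### The coordinates on `(ℝⁿ)^N` -/

theorem snocEquiv_castSucc {n N : ℕ} (p : RnPow n N × Rn n) (j : Fin N) :
    snocEquiv n N p j.castSucc = p.1 j := by
  simp [snocEquiv]

theorem snocEquiv_last {n N : ℕ} (p : RnPow n N × Rn n) :
    snocEquiv n N p (Fin.last N) = p.2 := by
  simp [snocEquiv]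

theorem inner_snocEquiv {n N : ℕ} (p q : RnPow n N × Rn n) :
    inner ℝ (snocEquiv n N p) (snocEquiv n N q) = inner ℝ p.1 q.1 + inner ℝ p.2 q.2 := by
  rw [PiLp.inner_apply, Fin.sum_univ_castSucc, PiLp.inner_apply p.1 q.1]
  simp only [snocEquiv_castSucc, snocEquiv_last]

/-- The product carries the sup norm, so `snocEquiv` is not itself an isometry. It becomes one after
passing to the `ℓ²` product, a change of norm that preserves the measure. -/
theorem measurePreserving_snocEquiv (n N : ℕ) : MeasurePreserving (snocEquiv n N) := by
  let L : WithLp 2 (RnPow n N × Rn n) ≃ₗᵢ[ℝ] RnPow n (N + 1) :=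
    LinearEquiv.isometryOfInner ((WithLp.linearEquiv 2 ℝ (RnPow n N × Rn n)).trans
      (snocEquiv n N).toLinearEquiv) fun p q => by
        rw [WithLp.prod_inner_apply]
        exact inner_snocEquiv _ _
  exact (L.measurePreserving).comp (WithLp.volume_preserving_toLp (RnPow n N) (Rn n))

theorem integral_comp_snocEquiv {n N : ℕ} (f : RnPow n (N + 1) → ℂ) :
    ∫ p, f (snocEquiv n N p) = ∫ ζ, f ζ :=
  (measurePreserving_snocEquiv n N).integral_comp
    (snocEquiv n N).toHomeomorph.measurableEmbedding f

/-- `singleEquiv` as a linear isometry. -/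
noncomputable def singleIsometry (n : ℕ) : Rn n ≃ₗᵢ[ℝ] RnPow n 1 :=
  LinearEquiv.isometryOfInner (singleEquiv n).toLinearEquiv fun x y => by
    rw [PiLp.inner_apply, Fin.sum_univ_one]
    rfl

theorem fourierInv_pairLast_multiplierKernel {n N : ℕ} (m : Rn n → ℂ)
    (hm : MemLp (fun ξ : Rn n => m ((2 * Real.pi) • ξ)) ⊤ volume) (Φ : 𝓢(RnPow n (N + 1), ℂ))
    (ξ : RnPow n N) :
    𝓕⁻ (pairLast (multiplierKernel m hm) Φ) ξ =
      ∫ η, 𝓕⁻ Φ (snocEquiv n N (ξ, η)) * m ((2 * Real.pi) • η) := by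
  refine fourierInv_partialPairing_apply hm _
    (compCLMOfContinuousLinearEquiv ℂ (snocEquiv n N) (𝓕⁻ Φ)) (fun x y => ?_) ξ
  have e : Φ (snocEquiv n N (x, y)) = 𝓕 (𝓕⁻ Φ) (snocEquiv n N (x, y)) := by
    rw [FourierTransform.fourier_fourierInv_eq]
  change Φ (snocEquiv n N (x, y)) = _
  rw [e, fourier_coe, Real.fourier_eq, ← integral_comp_snocEquiv]
  refine integral_congr_ae (.of_forall fun p => ?_)
  simp only [inner_snocEquiv, neg_add, AddChar.map_add_eq_mul, Circle.smul_def, Circle.coe_mul,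
    smul_eq_mul]
  rfl

/-! ### The symbols of the distributions -/

/-- Fubini between time and frequency: a time integral of pairings is the pairing with the
time-integrated symbol. It is used with `ν` the restriction to `(0, t]` for `Q_N` and to `(0, 2R]`
for `E_{N,R}`. -/
theorem integral_pairing_swap {n N : ℕ} (ν : Measure ℝ) [IsFiniteMeasure ν]
    (Ψ : 𝓢(RnPow n (N + 1), ℂ)) (q : RnPow n N → ℝ → ℂ) (m : Rn n → ℝ → ℂ) (c : ℝ)
    (hq : Continuous fun p : RnPow n N × ℝ => q p.1 p.2)
    (hm : Continuous fun p : Rn n × ℝ => m p.1 p.2)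
    (hb : ∀ᵐ s ∂ν, ∀ ξ η, ‖q ξ s * m η s‖ ≤ c) :
    ∫ s, (∫ ξ, (∫ η, Ψ (snocEquiv n N (ξ, η)) * m η s) * q ξ s) ∂ν =
      ∫ ζ, Ψ ζ * ∫ s, q (WithLp.toLp 2 fun j => ζ j.castSucc) s * m (ζ (Fin.last N)) s ∂ν := by
  have hΨ : Integrable Ψ volume := Ψ.integrable
  have hpr : Continuous fun ζ : RnPow n (N + 1) =>
      (WithLp.toLp 2 fun j => ζ j.castSucc : RnPow n N) := by fun_prop
  have hQ : Continuous fun p : ℝ × RnPow n (N + 1) =>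
      q (WithLp.toLp 2 fun j => p.2 j.castSucc) p.1 * m (p.2 (Fin.last N)) p.1 :=
    (hq.comp (f := fun p : ℝ × RnPow n (N + 1) =>
      ((WithLp.toLp 2 fun j => p.2 j.castSucc : RnPow n N), p.1)) (by fun_prop)).mul
      (hm.comp (f := fun p : ℝ × RnPow n (N + 1) => (p.2 (Fin.last N), p.1)) (by fun_prop))
  have e : ∀ᵐ s ∂ν, ∫ ξ, (∫ η, Ψ (snocEquiv n N (ξ, η)) * m η s) * q ξ s =
      ∫ ζ, Ψ ζ * (q (WithLp.toLp 2 fun j => ζ j.castSucc) s * m (ζ (Fin.last N)) s) := by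
    filter_upwards [hb] with s hs
    rw [← integral_comp_snocEquiv, Measure.volume_eq_prod, integral_prod]
    · refine integral_congr_ae (.of_forall fun ξ => ?_)
      simp only [← integral_mul_const]
      refine integral_congr_ae (.of_forall fun η => ?_)
      simp only [snocEquiv_castSucc, snocEquiv_last, WithLp.toLp_ofLp]
      ring
    · have h1 : Integrable (fun p => Ψ (snocEquiv n N p)) volume :=
        ((measurePreserving_snocEquiv n N).integrable_comp_emb
          (snocEquiv n N).toHomeomorph.measurableEmbedding).2 hΨ
      refine h1.mul_bdd (c := c) (Continuous.aestronglyMeasurable ?_) (.of_forall fun p => hs _ _)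
      exact (hQ.comp (Continuous.prodMk_right s)).comp (snocEquiv n N).continuous
  rw [integral_congr_ae e, integral_integral_swap]
  · simp only [integral_const_mul]
  · refine ((hΨ.comp_snd ν).mul_bdd (c := c) hQ.aestronglyMeasurable ?_)
    filter_upwards [Measure.quasiMeasurePreserving_fst.ae hb] with p hp
    exact hp _ _

theorem continuous_sineConv_norm (n M : ℕ) :
    Continuous fun p : RnPow n (M + 1) × ℝ =>
      sineConv M (fun j => ‖(2 * Real.pi) • p.1 j‖) p.2 :=
  (continuous_sineConv M).comp (f := fun p : RnPow n (M + 1) × ℝ =>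
    ((fun j => ‖(2 * Real.pi) • p.1 j‖), p.2)) (by fun_prop)

/-- Pairing off the last variable multiplies the transform by its symbol and integrates that
frequency out. The recursion for `Q_N` thus becomes the one defining `sineConv`. -/
theorem waveQ_eq_integral (n M : ℕ) (t : ℝ) (ht : 0 ≤ t) (Φ : 𝓢(RnPow n (M + 1), ℂ)) :
    waveQ n (M + 1) t Φ =
      ∫ ξ, 𝓕⁻ Φ ξ * sineConv M (fun j => ‖(2 * Real.pi) • ξ j‖) t := by
  induction M generalizing t with
  | zero =>
    simp only [waveQ, waveKernel, multiplierKernel_apply, sineConv]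
    rw [← (singleIsometry n).measurePreserving.integral_comp
      (singleIsometry n).toHomeomorph.measurableEmbedding]
    refine integral_congr_ae (.of_forall fun ξ => ?_)
    have h : 𝓕⁻ (compCLMOfContinuousLinearEquiv ℂ (singleEquiv n) Φ) ξ =
        𝓕⁻ Φ (singleIsometry n ξ) := by
      rw [fourierInv_coe, fourierInv_coe]
      exact Real.fourierInv_comp_linearIsometry (singleIsometry n) Φ ξ
    simp only [h]
    rfl
  | succ M ih =>
    have hsc := Real.continuous_sinc
    simp only [waveQ]
    rw [intervalIntegral.integral_of_le ht]
    have e : ∀ s ∈ Set.Ioc 0 t, waveQ n (M + 1) (t - s) (pairLast (waveKernel n s) Φ) =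
        ∫ ξ : RnPow n (M + 1), (∫ η, 𝓕⁻ Φ (snocEquiv n (M + 1) (ξ, η)) *
          ((s * Real.sinc (s * ‖(2 * Real.pi) • η‖) : ℝ) : ℂ)) *
            sineConv M (fun j => ‖(2 * Real.pi) • ξ j‖) (t - s) := fun s hs => by
      rw [ih (t - s) (by linarith [hs.2])]
      simp only [waveKernel, fourierInv_pairLast_multiplierKernel]
    rw [setIntegral_congr_fun measurableSet_Ioc e,
      integral_pairing_swap (volume.restrict (Set.Ioc 0 t)) (𝓕⁻ Φ)
        (fun ξ s => sineConv M (fun j => ‖(2 * Real.pi) • ξ j‖) (t - s))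
        (fun η s => ((s * Real.sinc (s * ‖(2 * Real.pi) • η‖) : ℝ) : ℂ)) (t ^ (2 * M + 1) * t)]
    · refine integral_congr_ae (.of_forall fun ζ => ?_)
      simp only [sineConv, intervalIntegral.integral_of_le ht]
    · exact (continuous_sineConv_norm n M).comp (f := fun p : RnPow n (M + 1) × ℝ =>
        (p.1, t - p.2)) (by fun_prop)
    · fun_prop
    · filter_upwards [ae_restrict_mem measurableSet_Ioc] with s hs ξ η
      have h1 : 0 ≤ t - s := by linarith [hs.2]
      rw [norm_mul, Complex.norm_real, Real.norm_eq_abs]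
      refine mul_le_mul ((norm_sineConv_le _ _ _).trans ?_) ((abs_mul_sinc_le _ _).trans ?_)
        (abs_nonneg _) (by positivity)
      · rw [abs_of_nonneg h1]
        exact pow_le_pow_left₀ h1 (by linarith [hs.1]) _
      · rw [abs_of_nonneg hs.1.le]
        exact hs.2

theorem setIntegral_Ioi_eq_intervalIntegral {f : ℝ → ℂ} {T : ℝ} (hT : 0 ≤ T)
    (h : ∀ t, T < t → f t = 0) : ∫ t in Set.Ioi (0 : ℝ), f t = ∫ t in (0 : ℝ)..T, f t := by
  rw [intervalIntegral.integral_of_le hT]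
  refine setIntegral_eq_of_subset_of_forall_sdiff_eq_zero measurableSet_Ioi
    Set.Ioc_subset_Ioi_self fun t ht => h t ?_
  by_contra h'
  exact ht.2 ⟨ht.1, not_lt.1 h'⟩

/-- The Fourier transform of `E_{M+2,R}`. -/
noncomputable def cutoffSymbol (n : ℕ) (χ : ℕ → ℝ → ℂ) (M : ℕ) (R : ℝ) (ξ : RnPow n (M + 2)) : ℂ :=
  (-1) ^ (M + 1) * ∫ t in (0 : ℝ)..(2 * R), sineConv M (fun j => ‖ξ j.castSucc‖) t *
    (Real.cos (t * ‖ξ (Fin.last (M + 1))‖) : ℂ) * χ (M + 2) (t / R)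

/-! ### Continuity and bounds for the symbol of `E_{N,R}` -/

section CutoffSymbol

variable {n M : ℕ} {A : ℝ} {χ : ℕ → ℝ → ℂ} {R : ℝ}

theorem continuous_cutoffSymbol (hχ : Continuous (χ (M + 2))) :
    Continuous (cutoffSymbol n χ M R) := by
  unfold cutoffSymbol
  refine continuous_const.mul
    (intervalIntegral.continuous_parametric_intervalIntegral_of_continuous' ?_ _ _)
  refine Continuous.mul (Continuous.mul ((continuous_sineConv M).comp
    (f := fun p : RnPow n (M + 2) × ℝ => ((fun j : Fin (M + 1) => ‖p.1 j.castSucc‖), p.2))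
    (by fun_prop)) (by fun_prop)) (by fun_prop)

theorem cutoff_eq_zero (hχ : IsCutoffSequence A χ) (hR : 0 < R) {N : ℕ} (hN : 1 ≤ N) (t : ℝ)
    (ht : 2 * R < t) : χ N (t / R) = 0 := by
  refine hχ.eq_zero N hN _ (lt_of_lt_of_le ?_ (le_abs_self _))
  rwa [lt_div_iff₀ hR]

theorem norm_cutoff_le (hχ : IsCutoffSequence A χ) {N : ℕ} (hN : 1 ≤ N) (t : ℝ) :
    ‖χ N t‖ ≤ 1 := by
  simpa using hχ.bound N hN 0 (by omega) t

/-- Uniformity in `ξ` is all that matters here: it puts the symbol in `L^∞`, so that it defines a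
tempered distribution. -/
theorem norm_cutoffSymbol_le (hχ : IsCutoffSequence A χ) (hR : 0 < R) (ξ : RnPow n (M + 2)) :
    ‖cutoffSymbol n χ M R ξ‖ ≤ (2 * R) ^ (2 * M + 1) * |2 * R - 0| := by
  rw [cutoffSymbol, norm_mul, norm_pow, norm_neg, norm_one, one_pow, one_mul]
  refine intervalIntegral.norm_integral_le_of_norm_le_const fun t ht => ?_
  rw [Set.uIoc_of_le (by positivity)] at ht
  have h1 := (norm_sineConv_le M (fun j => ‖ξ j.castSucc‖) t).trans
    (pow_le_pow_left₀ (abs_nonneg _) ((abs_of_nonneg ht.1.le).trans_le ht.2) _)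
  have h2 : ‖(Real.cos (t * ‖ξ (Fin.last (M + 1))‖) : ℂ)‖ ≤ 1 := by
    rw [Complex.norm_real]
    exact Real.abs_cos_le_one _
  rw [norm_mul, norm_mul]
  calc _ ≤ (2 * R) ^ (2 * M + 1) * 1 * 1 := by
        gcongr
        exact norm_cutoff_le hχ (by omega) _
    _ = _ := by ring

theorem cutoffE_eq_integral (hχ : IsCutoffSequence A χ) (hR : 0 < R)
    (Φ : 𝓢(RnPow n (M + 2), ℂ)) :
    cutoffE n χ (M + 2) R Φ = ∫ ξ, 𝓕⁻ Φ ξ * cutoffSymbol n χ M R ((2 * Real.pi) • ξ) := by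
  have hχc : Continuous (χ (M + 2)) := (hχ.smooth (M + 2) (by omega)).continuous
  have hR2 : 0 ≤ 2 * R := by positivity
  simp only [cutoffE]
  rw [setIntegral_Ioi_eq_intervalIntegral hR2 fun t ht => by
    rw [cutoff_eq_zero hχ hR (by omega) t ht, mul_zero], intervalIntegral.integral_of_le hR2]
  have e : ∀ t ∈ Set.Ioc 0 (2 * R),
      waveQ n (M + 1) t (pairLast (waveKernelDot n t) Φ) * χ (M + 2) (t / R) =
        ∫ ξ : RnPow n (M + 1), (∫ η, 𝓕⁻ Φ (snocEquiv n (M + 1) (ξ, η)) *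
          ((Real.cos (t * ‖(2 * Real.pi) • η‖) : ℝ) : ℂ)) *
            (sineConv M (fun j => ‖(2 * Real.pi) • ξ j‖) t * χ (M + 2) (t / R)) := fun t ht => by
    rw [waveQ_eq_integral n M t ht.1.le, ← integral_mul_const]
    simp only [waveKernelDot, fourierInv_pairLast_multiplierKernel, mul_assoc]
  rw [setIntegral_congr_fun measurableSet_Ioc e,
    integral_pairing_swap (volume.restrict (Set.Ioc 0 (2 * R))) (𝓕⁻ Φ)
      (fun ξ t => sineConv M (fun j => ‖(2 * Real.pi) • ξ j‖) t * χ (M + 2) (t / R))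
      (fun η t => ((Real.cos (t * ‖(2 * Real.pi) • η‖) : ℝ) : ℂ)) ((2 * R) ^ (2 * M + 1)),
    ← integral_const_mul]
  · refine integral_congr_ae (.of_forall fun ζ => ?_)
    simp only [cutoffSymbol, intervalIntegral.integral_of_le hR2, PiLp.smul_apply]
    rw [mul_left_comm]
    congr 3
    ext t
    ring
  · exact (continuous_sineConv_norm n M).mul (by fun_prop)
  · fun_prop
  · filter_upwards [ae_restrict_mem measurableSet_Ioc] with t ht ξ η
    have h1 := (norm_sineConv_le M (fun j => ‖(2 * Real.pi) • ξ j‖) t).trans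
      (pow_le_pow_left₀ (abs_nonneg _) ((abs_of_nonneg ht.1.le).trans_le ht.2) _)
    rw [norm_mul, norm_mul, Complex.norm_real]
    calc _ ≤ (2 * R) ^ (2 * M + 1) * 1 * 1 := by
          gcongr
          · exact norm_cutoff_le hχ (by omega) _
          · exact Real.abs_cos_le_one _
      _ = _ := by ring

theorem norm_cutoffSymbol_le_prod (hχ : IsCutoffSequence A χ) (hR : 0 < R) {γ : ℝ} (hγ : 0 < γ)
    (ξ : RnPow n (M + 2)) :
    ‖cutoffSymbol n χ M R ξ‖ ≤ 8 ^ (M + 2) * (|A| * ((M + 2 : ℕ) / R) / γ) ^ (2 * M + 5) *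
      Real.exp (2 * R * γ) * ∏ j : Fin (M + 1),
        hWeight γ ‖ξ j.castSucc‖ ‖ξ (Fin.last (M + 1))‖ := by
  have hN : 1 ≤ M + 2 := by omega
  have hR2 : 0 ≤ 2 * R := by positivity
  set r : Fin (M + 1) → ℝ := fun j => ‖ξ j.castSucc‖
  set s := ‖ξ (Fin.last (M + 1))‖
  set u := leftCutoff χ (M + 2) R
  have hu : ContDiff ℝ ∞ u := contDiff_leftCutoff hχ hN hR
  have h0 : ∀ t, 2 * R < t → u t = 0 := leftCutoff_eq_zero hχ hN hR
  have hI : ∀ σ : ℝ, ‖∫ t in (0 : ℝ)..(2 * R), sineConv M r t *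
      (Complex.exp ((σ * t : ℝ) * Complex.I) * u t)‖ ≤
      8 ^ (M + 2) * (|A| * ((M + 2 : ℕ) / R) / γ) ^ (2 * M + 5) *
        Real.exp (2 * R * γ) * ∏ j, hWeight γ (r j) σ := fun σ => by
    rw [← setIntegral_Ioi_eq_intervalIntegral hR2 fun t ht => by rw [h0 t ht, mul_zero, mul_zero]]
    exact norm_integral_sineConv_mul_le hγ M r σ u hu (by positivity) h0
      fun k hk => norm_iteratedDeriv_leftCutoff_le hχ hN hR k (by omega)
  have hi : ∀ σ : ℝ, IntervalIntegrable (fun t : ℝ => sineConv M r t *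
      (Complex.exp ((σ * t : ℝ) * Complex.I) * u t)) volume 0 (2 * R) := fun σ => by
    have h1 : Continuous (fun t : ℝ => sineConv M r t) :=
      (continuous_sineConv M).comp (Continuous.prodMk_right r)
    have := hu.continuous
    exact Continuous.intervalIntegrable (by fun_prop) _ _
  -- The cosine is the mean of `exp (ist)` and `exp (-ist)`. Evenness of `h_γ` gives both halves the
  -- same bound, and `u` equals the rescaled cut-off for `t ≥ 0`.
  have e : ∫ t in (0 : ℝ)..(2 * R), sineConv M r t * (Real.cos (t * s) : ℂ) * χ (M + 2) (t / R) =
      ((∫ t in (0 : ℝ)..(2 * R), sineConv M r t * (Complex.exp ((s * t : ℝ) * Complex.I) * u t)) +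
        ∫ t in (0 : ℝ)..(2 * R), sineConv M r t *
          (Complex.exp ((-s * t : ℝ) * Complex.I) * u t)) / 2 := by
    rw [← intervalIntegral.integral_add (hi s) (hi (-s)), ← intervalIntegral.integral_div]
    refine intervalIntegral.integral_congr fun t ht => ?_
    rw [Set.uIcc_of_le hR2] at ht
    have hut : u t = χ (M + 2) (t / R) := by
      rw [div_eq_inv_mul]
      exact if_neg (not_lt.2 ht.1)
    simp only [hut, Complex.ofReal_cos, Complex.cos]
    push_cast
    ring_nf
  have h2 := hI s
  have h3 := hI (-s)
  simp only [hWeight_neg_right] at h3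
  rw [cutoffSymbol, norm_mul, norm_pow, norm_neg, norm_one, one_pow, one_mul, e, norm_div]
  have h4 := norm_add_le _ _ |>.trans (add_le_add h2 h3)
  rw [Complex.norm_ofNat]
  linarith

end CutoffSymbol

/-! ### Conclusion -/

theorem mainTheorem6 (n : ℕ) (hn : 3 ≤ n) (hodd : Odd n) (A : ℝ) :
    ∃ C : ℝ, 0 < C ∧ ∀ χ : ℕ → ℝ → ℂ, IsCutoffSequence A χ →
      ∀ (N : ℕ) (hN : 2 ≤ N) (R : ℝ), 0 < R →
        ∃ E : 𝓢'(RnPow n N, ℂ), (∀ Φ : 𝓢(RnPow n N, ℂ), E Φ = cutoffE n χ N R Φ) ∧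
          ∃ F : RnPow n N → ℂ, HasFourierTransform E F ∧
            ∀ (γ : ℝ), 0 < γ → ∀ ξ : RnPow n N,
              ‖F ξ‖ ≤ C ^ N * ((N : ℝ) / (R * γ)) ^ (2 * N + 1) * Real.exp (2 * R * γ) *
                ∏ j : Fin (N - 1),
                  hWeight γ ‖ξ (j.castLE (Nat.sub_le N 1))‖ ‖ξ ⟨N - 1, by omega⟩‖ := by
  -- The `8` is the base in the basic estimate. With `N = M + 2`, the factor `|A|^(2N+1)` is
  -- absorbed by `(1 + |A|)^(3N)`, since `2N + 1 ≤ 3N`.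
  refine ⟨8 * (1 + |A|) ^ 3, by positivity, fun χ hχ N hN R hR => ?_⟩
  obtain ⟨M, rfl⟩ : ∃ M, N = M + 2 := ⟨N - 2, by omega⟩
  have hc : Continuous (cutoffSymbol n χ M R) :=
    continuous_cutoffSymbol (hχ.smooth (M + 2) (by omega)).continuous
  have hF : MemLp (fun ξ => cutoffSymbol n χ M R ((2 * Real.pi) • ξ)) ⊤ volume :=
    memLp_top_of_bound (Continuous.aestronglyMeasurable (by fun_prop)) _
      (.of_forall fun ξ => norm_cutoffSymbol_le hχ hR _)
  -- `E` is built from its symbol, so its Fourier transform is known by inversion; agreement with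
  -- `cutoffE` is `cutoffE_eq_integral`.
  refine ⟨𝓕⁻ (Lp.toTemperedDistribution hF.toLp), fun Φ => ?_, cutoffSymbol n χ M R,
    ⟨hc, fun φ => ?_⟩, fun γ hγ ξ => (norm_cutoffSymbol_le_prod hχ hR hγ ξ).trans ?_⟩
  · rw [cutoffE_eq_integral hχ hR, TemperedDistribution.fourierInv_apply,
      toTemperedDistribution_toLp_apply]
  · rw [FourierTransform.fourier_fourierInv_eq, toTemperedDistribution_toLp_apply]
    simp only [mul_comm]
  · have h1 : |A| ^ (2 * M + 5) ≤ ((1 + |A|) ^ 3) ^ (M + 2) := by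
      rw [← pow_mul]
      exact (pow_le_pow_left₀ (abs_nonneg A) (by linarith) _).trans
        (pow_le_pow_right₀ (by linarith [abs_nonneg A]) (by omega))
    have h2 : 0 ≤ ∏ j : Fin (M + 1), hWeight γ ‖ξ j.castSucc‖ ‖ξ (Fin.last (M + 1))‖ :=
      Finset.prod_nonneg fun _ _ => hWeight_nonneg hγ _ _
    refine mul_le_mul_of_nonneg_right ?_ h2
    refine mul_le_mul_of_nonneg_right ?_ (Real.exp_nonneg _)
    have h3 : |A| * ((M + 2 : ℕ) / R) / γ = |A| * ((M + 2 : ℕ) / (R * γ)) := by field_simp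
    rw [h3, mul_pow, mul_pow, ← mul_assoc, show 2 * (M + 2) + 1 = 2 * M + 5 by ring]
    gcongr
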